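/- Conventions. A graph is a graph in the sense of Serre: a disjoint union of a set $V$ of vertices and a set $E$ of edges, with source and target maps $s,t:E\to V$ and a fixed-point free involution $e\mapsto\bar e$ of $E$ with $s(\bar e)=t(e)$, $t(\bar e)=s(e)$; maps of graphs preserve all this structure. A path connected graph is nonempty. A compatible equivalence relation on a graph relates vertices only to vertices and edges only to edges, respects sources, targets and inverses, and never relates $e$ to $\bar e$. A profinite graph is a graph with a compact Hausdorff uniformity for which the compatible cofinite entourages (entourages that are compatible equivalence relations with finite quotient) form a fundamental system of entourages. It is connected if its quotient by each compatible cofinite entourage is path connected. A map of profinite graphs $f:\Gamma\to\Delta$ is a covering if it is the inverse limit, over a directed set, of an inverse system of locally bijective maps $f_i:\Gamma_i\to\Delta_i$ of finite discrete graphs; it is a regular covering if the $f_i$ can be chosen to be regular coverings of path connected finite discrete graphs (locally bijective, with the covering transformations acting transitively on each vertex fiber). A homomorphism of coverings $(\Gamma_1,f_1)\to(\Gamma_2,f_2)$ of $\Delta$ is a continuous map of graphs $h$ with $f_2h=f_1$. A universal profinite covering graph of a connected profinite graph $\Delta$ is a covering $(\widetilde\Delta,p)$ of $\Delta$ with $\widetilde\Delta$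 connected such that for every covering $(\Gamma,f)$ of $\Delta$ with $\Gamma$ connected, and all vertices $c$ of $\widetilde\Delta$ and $a$ of $\Gamma$ with $p(c)=f(a)$, there is a homomorphism of coverings $h$ from $(\widetilde\Delta,p)$ to $(\Gamma,f)$ with $h(c)=a$. Theorem. Let $\Delta$ be a connected profinite graph. Then a universal profinite covering graph of $\Delta$ exists. Moreover, every universal profinite covering graph $(\widetilde\Delta,p)$ of $\Delta$ has the following properties. (1) $p$ is a regular covering. (2) Let $c$ be a vertex of $\widetilde\Delta$ and $b=p(c)$. Let $J$ be the set of pairs $(S,N)$ where $S$ is a compatible cofinite entourage of $\Delta$ and $N$ is a normal subgroup of finite index of $\pi_1(\Delta/S,S[b])$, ordered by $(S,N)\le(P,M)$ if and only if $P\subseteq S$ and the natural map $\Delta/P\to\Delta/S$ carries $M$ into $N$. Then $J$ is nonempty and directed, and $p$ is the inverse limit of an inverse system, indexed by $J$, of regular coverings $f_{SN}:(\Gamma_{SN},a_{SN})\to(\Delta/S,S[b])$ of path connected finite graphs with $f_{SN}\bigl(\pi_1(\Gamma_{SN},a_{SN})\bigr)=N$; here the transition maps $\Delta/P\to\Delta/S$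 and the projections $\Delta\to\Delta/S$ are the natural ones, the transition maps $\Gamma_{PM}\to\Gamma_{SN}$ carry $a_{PM}$ to $a_{SN}$, and the projections $\widetilde\Delta\to\Gamma_{SN}$ carry $c$ to $a_{SN}$. (3) If $(\Sigma,g)$ is a covering of $\Delta$ with $\Sigma$ connected and $h$ is a homomorphism of coverings from $(\widetilde\Delta,p)$ to $(\Sigma,g)$, then $h:\widetilde\Delta\to\Sigma$ is a regular covering. -/

import Mathlib

universe u

/-- An abstract graph (in the sense of Serre): vertices, oriented edges, source and target maps and
a fixed-point free involution `inv` on edges exchanging source and target. As a set, the graph is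
the disjoint union of `V` and `E`. -/
structure SerreGraph : Type (u + 1) where
  V : Type u
  E : Type u
  src : E → V
  tgt : E → V
  inv : E → E
  inv_inv : ∀ e, inv (inv e) = e
  inv_ne : ∀ e, inv e ≠ e
  src_inv : ∀ e, src (inv e) = tgt e
  tgt_inv : ∀ e, tgt (inv e) = src e

namespace SerreGraph

/-- A map of graphs. -/
@[ext]
structure Hom (G H : SerreGraph.{u}) : Type u where
  onV : G.V → H.V
  onE : G.E → H.E
  src_comm : ∀ e, H.src (onE e) = onV (G.src e)
  tgt_comm : ∀ e, H.tgt (onE e) = onV (G.tgt e)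
  inv_comm : ∀ e, H.inv (onE e) = onE (G.inv e)

/-- The identity map of a graph. -/
def Hom.id (G : SerreGraph.{u}) : Hom G G where
  onV := fun v => v
  onE := fun e => e
  src_comm := fun _ => rfl
  tgt_comm := fun _ => rfl
  inv_comm := fun _ => rfl

/-- Composition `g ∘ f` of maps of graphs. -/
def Hom.comp {G H K : SerreGraph.{u}} (g : Hom H K) (f : Hom G H) : Hom G K where
  onV := fun v => g.onV (f.onV v)
  onE := fun e => g.onE (f.onE e)
  src_comm := fun e => by rw [g.src_comm, f.src_comm]
  tgt_comm := fun e => by rw [g.tgt_comm, f.tgt_comm]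
  inv_comm := fun e => by rw [g.inv_comm, f.inv_comm]

/-- `f` restricts to a bijection from the edges starting at `v` to the edges starting at `f v`, for
each vertex `v`. -/
def Hom.LocallyBijective {G H : SerreGraph.{u}} (f : Hom G H) : Prop :=
  ∀ (v : G.V) (e' : H.E), H.src e' = f.onV v → ∃! e : G.E, G.src e = v ∧ f.onE e = e'

/-- The list of edges `l` is an edge path from `u` to `v`. -/
def IsWalk (G : SerreGraph.{u}) (u : G.V) : List G.E → G.V → Prop
  | [], v => u = v
  | e :: l, v => G.src e = u ∧ IsWalk G (G.tgt e) l v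

/-- Path connectedness (a path connected graph is nonempty). -/
def PathConnected (G : SerreGraph.{u}) : Prop :=
  Nonempty G.V ∧ ∀ u v : G.V, ∃ l, G.IsWalk u l v

/-- `f : G → H` is a regular covering of path connected graphs: it is locally bijective and its
group of covering transformations acts transitively on each vertex fiber. -/
def Hom.IsRegularCovering {G H : SerreGraph.{u}} (f : Hom G H) : Prop :=
  G.PathConnected ∧ H.PathConnected ∧ f.LocallyBijective ∧
    ∀ a₁ a₂ : G.V, f.onV a₁ = f.onV a₂ →
      ∃ α β : Hom G G, α.comp β = Hom.id G ∧ β.comp α = Hom.id G ∧ f.comp α = f ∧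
        α.onV a₁ = a₂

/-! ### The fundamental group of an abstract graph -/

section FundamentalGroup

variable {G H K : SerreGraph.{u}}

theorem IsWalk.append {l₁ l₂ : List G.E} : ∀ {u v w : G.V}, G.IsWalk u l₁ v → G.IsWalk v l₂ w →
    G.IsWalk u (l₁ ++ l₂) w := by
  induction l₁ with
  | nil => intro u v w h₁ h₂; cases h₁; exact h₂
  | cons e l ih => intro u v w h₁ h₂; exact ⟨h₁.1, ih h₁.2 h₂⟩

theorem IsWalk.reverse {l : List G.E} : ∀ {u v : G.V}, G.IsWalk u l v →
    G.IsWalk v (l.map G.inv).reverse u := by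
  induction l with
  | nil => intro u v h; exact Eq.symm h
  | cons e l ih =>
    intro u v h
    rw [List.map_cons, List.reverse_cons]
    refine (ih h.2).append ⟨G.src_inv e, ?_⟩
    exact (G.tgt_inv e).trans h.1

theorem IsWalk.map (f : Hom G H) {l : List G.E} : ∀ {u v : G.V}, G.IsWalk u l v →
    H.IsWalk (f.onV u) (l.map f.onE) (f.onV v) := by
  induction l with
  | nil => intro u v h; exact congrArg f.onV h
  | cons e l ih =>
    intro u v h
    refine ⟨(f.src_comm e).trans (congrArg f.onV h.1), ?_⟩
    have := ih h.2
    rwa [← f.tgt_comm] at this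

/-- Edge paths from `u` to `v`. -/
def Walk (G : SerreGraph.{u}) (u v : G.V) : Type u := {l : List G.E // G.IsWalk u l v}

/-- Elementary reduction of edge paths: deleting a segment `e, inv e`. -/
def WalkStep {u v : G.V} (p q : G.Walk u v) : Prop :=
  ∃ l₁ e l₂, p.1 = l₁ ++ e :: G.inv e :: l₂ ∧ q.1 = l₁ ++ l₂

/-- Homotopy classes of edge paths from `u` to `v`: the quotient by the equivalence relation
generated by elementary reductions. -/
def PathClass (G : SerreGraph.{u}) (u v : G.V) : Type u := Quot (WalkStep (G := G) (u := u) (v := v))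

/-- Concatenation of homotopy classes. -/
def PathClass.comp {u v w : G.V} : G.PathClass u v → G.PathClass v w → G.PathClass u w :=
  Quot.map₂ (fun p q => ⟨p.1 ++ q.1, p.2.append q.2⟩)
    (by
      rintro p q q' ⟨l₁, e, l₂, h, h'⟩
      exact ⟨p.1 ++ l₁, e, l₂, by simp [h], by simp [h']⟩)
    (by
      rintro p p' q ⟨l₁, e, l₂, h, h'⟩
      exact ⟨l₁, e, l₂ ++ q.1, by simp [h], by simp [h']⟩)

/-- The inverse homotopy class. -/
def PathClass.symm {u v : G.V} : G.PathClass u v → G.PathClass v u :=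
  Quot.map (fun p => ⟨(p.1.map G.inv).reverse, p.2.reverse⟩)
    (by
      rintro p q ⟨l₁, e, l₂, h, h'⟩
      exact ⟨(l₂.map G.inv).reverse, G.inv (G.inv e), (l₁.map G.inv).reverse,
        by simp [h, G.inv_inv], by simp [h']⟩)

/-- The homotopy class of the constant path. -/
def PathClass.refl (G : SerreGraph.{u}) (v : G.V) : G.PathClass v v := Quot.mk _ ⟨[], rfl⟩

theorem Walk.reverse_append {l : List G.E} : ∀ {u v : G.V} (hl : G.IsWalk u l v),
    Quot.mk WalkStep (⟨(l.map G.inv).reverse ++ l, hl.reverse.append hl⟩ : G.Walk v v) =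
      PathClass.refl G v := by
  induction l with
  | nil => intro u v hl; rfl
  | cons e l ih =>
    intro u v hl
    rw [← ih hl.2]
    apply Quot.sound
    exact ⟨(l.map G.inv).reverse, G.inv e, l, by simp [G.inv_inv], rfl⟩

theorem PathClass.symm_comp {u v : G.V} (p : G.PathClass u v) :
    p.symm.comp p = PathClass.refl G v := by
  obtain ⟨l, hl⟩ := p
  exact Walk.reverse_append hl

/-- The fundamental group `π₁(G, b)`: homotopy classes of closed edge paths at `b`. -/
def Pi1 (G : SerreGraph.{u}) (b : G.V) : Type u := G.PathClass b b

instance (G : SerreGraph.{u}) (b : G.V) : Group (G.Pi1 b) where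
  mul := PathClass.comp
  one := PathClass.refl G b
  inv := PathClass.symm
  mul_assoc := by
    rintro ⟨p⟩ ⟨q⟩ ⟨r⟩
    exact congrArg (Quot.mk _) (Subtype.ext (List.append_assoc p.1 q.1 r.1))
  one_mul := by
    rintro ⟨p⟩
    exact congrArg (Quot.mk _) (Subtype.ext (List.nil_append p.1))
  mul_one := by
    rintro ⟨p⟩
    exact congrArg (Quot.mk _) (Subtype.ext (List.append_nil p.1))
  inv_mul_cancel := PathClass.symm_comp

theorem IsWalk.map_loop (f : Hom G H) {a : G.V} {b : H.V} (h : f.onV a = b) {l : List G.E}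
    (hl : G.IsWalk a l a) : H.IsWalk b (l.map f.onE) b := by
  subst h
  exact hl.map f

/-- The homomorphism `π₁(G, a) → π₁(H, b)` induced by a map of graphs `f` with `f a = b`. -/
def pi1Map (f : Hom G H) {a : G.V} {b : H.V} (h : f.onV a = b) : G.Pi1 a →* H.Pi1 b where
  toFun := Quot.map (fun p => ⟨p.1.map f.onE, p.2.map_loop f h⟩)
    (by
      rintro p q ⟨l₁, e, l₂, hp, hq⟩
      exact ⟨l₁.map f.onE, f.onE e, l₂.map f.onE, by simp [hp, f.inv_comm], by simp [hq]⟩)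
  map_one' := rfl
  map_mul' := by
    rintro ⟨p⟩ ⟨q⟩
    exact congrArg (Quot.mk _) (Subtype.ext (List.map_append))

end FundamentalGroup

/-! ### Compatible equivalence relations and quotient graphs -/

/-- A compatible equivalence relation on a graph: it relates vertices only to vertices and edges
only to edges, respects sources, targets and inverses, and never identifies an edge with its
inverse. -/
structure CompatRel (G : SerreGraph.{u}) : Type u where
  relV : Setoid G.V
  relE : Setoid G.E
  src_rel : ∀ e e', relE e e' → relV (G.src e) (G.src e')
  tgt_rel : ∀ e e', relE e e' → relV (G.tgt e) (G.tgt e')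
  inv_rel : ∀ e e', relE e e' → relE (G.inv e) (G.inv e')
  not_inv_rel : ∀ e, ¬ relE (G.inv e) e

/-- The quotient graph `G / R`. -/
def quot (G : SerreGraph.{u}) (R : G.CompatRel) : SerreGraph.{u} where
  V := Quotient R.relV
  E := Quotient R.relE
  src := Quotient.map G.src R.src_rel
  tgt := Quotient.map G.tgt R.tgt_rel
  inv := Quotient.map G.inv R.inv_rel
  inv_inv := by rintro ⟨e⟩; exact congrArg (Quotient.mk R.relE) (G.inv_inv e)
  inv_ne := by rintro ⟨e⟩ h; exact R.not_inv_rel e (Quotient.exact h)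
  src_inv := by rintro ⟨e⟩; exact congrArg (Quotient.mk R.relV) (G.src_inv e)
  tgt_inv := by rintro ⟨e⟩; exact congrArg (Quotient.mk R.relV) (G.tgt_inv e)

/-- The projection `G → G / R`. -/
def proj (G : SerreGraph.{u}) (R : G.CompatRel) : Hom G (G.quot R) where
  onV := Quotient.mk R.relV
  onE := Quotient.mk R.relE
  src_comm := fun _ => rfl
  tgt_comm := fun _ => rfl
  inv_comm := fun _ => rfl

/-- `R` is contained in `S`. -/
def CompatRel.Finer {G : SerreGraph.{u}} (R S : G.CompatRel) : Prop :=
  R.relV ≤ S.relV ∧ R.relE ≤ S.relE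

/-- The natural map `G / R → G / S` for `R ⊆ S`. -/
def quotMap {G : SerreGraph.{u}} {R S : G.CompatRel} (h : R.Finer S) :
    Hom (G.quot R) (G.quot S) where
  onV := Quotient.map (fun v => v) (fun _ _ hv => h.1 hv)
  onE := Quotient.map (fun e => e) (fun _ _ he => h.2 he)
  src_comm := by rintro ⟨e⟩; rfl
  tgt_comm := by rintro ⟨e⟩; rfl
  inv_comm := by rintro ⟨e⟩; rfl

/-! ### Inverse systems of graphs -/

/-- An inverse system of graphs indexed by `I`. -/
structure System (I : Type u) [Preorder I] : Type (u + 1) where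
  obj : I → SerreGraph.{u}
  map : ∀ {i j : I}, i ≤ j → Hom (obj j) (obj i)
  map_refl : ∀ i : I, map (le_refl i) = Hom.id (obj i)
  map_trans : ∀ {i j k : I} (hij : i ≤ j) (hjk : j ≤ k),
    map (hij.trans hjk) = (map hij).comp (map hjk)

/-- A morphism of inverse systems, that is, an inverse system of maps of graphs. -/
structure SystemMap {I : Type u} [Preorder I] (A B : System I) : Type u where
  app : ∀ i : I, Hom (A.obj i) (B.obj i)
  comm : ∀ {i j : I} (h : i ≤ j), (app i).comp (A.map h) = (B.map h).comp (app j)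

/-- All graphs in the system are finite. -/
def System.IsFinite {I : Type u} [Preorder I] (A : System I) : Prop :=
  ∀ i, Finite (A.obj i).V ∧ Finite (A.obj i).E

end SerreGraph

/-- A profinite graph: a graph with a compact Hausdorff uniformity for which the compatible cofinite
entourages form a fundamental system of entourages. (As compatible relations do not relate vertices
and edges, this uniform space is the disjoint sum of the uniform spaces `V` and `E`.) -/
structure ProfiniteGraph : Type (u + 1) extends SerreGraph.{u} where
  uniformV : UniformSpace V
  uniformE : UniformSpace E
  compactV : CompactSpace V
  compactE : CompactSpace E
  hausdorffV : T2Space V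
  hausdorffE : T2Space E
  exists_compatRel : ∀ W ∈ uniformity V, ∀ W' ∈ uniformity E,
    ∃ R : toSerreGraph.CompatRel,
      ({x : V × V | R.relV x.1 x.2} ∈ uniformity V ∧ {x : E × E | R.relE x.1 x.2} ∈ uniformity E ∧
        Finite (Quotient R.relV) ∧ Finite (Quotient R.relE)) ∧
      {x : V × V | R.relV x.1 x.2} ⊆ W ∧ {x : E × E | R.relE x.1 x.2} ⊆ W'

namespace ProfiniteGraph

open SerreGraph

instance (Γ : ProfiniteGraph.{u}) : UniformSpace Γ.V := Γ.uniformV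
instance (Γ : ProfiniteGraph.{u}) : UniformSpace Γ.E := Γ.uniformE
instance (Γ : ProfiniteGraph.{u}) : CompactSpace Γ.V := Γ.compactV
instance (Γ : ProfiniteGraph.{u}) : CompactSpace Γ.E := Γ.compactE
instance (Γ : ProfiniteGraph.{u}) : T2Space Γ.V := Γ.hausdorffV
instance (Γ : ProfiniteGraph.{u}) : T2Space Γ.E := Γ.hausdorffE

/-- The compatible relation `R` is a cofinite entourage: an entourage with finite quotient. -/
def IsCofiniteEntourage (Γ : ProfiniteGraph.{u}) (R : Γ.toSerreGraph.CompatRel) : Prop :=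
  {x : Γ.V × Γ.V | R.relV x.1 x.2} ∈ uniformity Γ.V ∧
    {x : Γ.E × Γ.E | R.relE x.1 x.2} ∈ uniformity Γ.E ∧
    Finite (Quotient R.relV) ∧ Finite (Quotient R.relE)

/-- A profinite graph is connected if its quotients by compatible cofinite entourages are path
connected (in particular, nonempty). -/
def IsConnected (Γ : ProfiniteGraph.{u}) : Prop :=
  ∀ R : Γ.toSerreGraph.CompatRel, Γ.IsCofiniteEntourage R → (Γ.toSerreGraph.quot R).PathConnected

/-- A continuous map of profinite graphs. -/
structure Map (Γ Δ : ProfiniteGraph.{u}) : Type u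
    extends SerreGraph.Hom Γ.toSerreGraph Δ.toSerreGraph where
  continuous_onV : Continuous onV
  continuous_onE : Continuous onE

/-- The profinite graph `Γ`, with the projections `π i`, is the inverse limit of the inverse system
`A` of finite discrete graphs: the projections are compatible and continuous (that is, locally
constant), and they identify `Γ` with the graph of compatible families. The resulting continuous
bijection is automatically a homeomorphism, since `Γ` is compact. -/
structure IsLimit {I : Type u} [Preorder I] (A : System I) (Γ : ProfiniteGraph.{u})
    (π : ∀ i, SerreGraph.Hom Γ.toSerreGraph (A.obj i)) : Prop where
  continuous_onV : ∀ i, IsLocallyConstant (π i).onV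
  continuous_onE : ∀ i, IsLocallyConstant (π i).onE
  comm : ∀ {i j : I} (h : i ≤ j), (A.map h).comp (π j) = π i
  existsUnique_V : ∀ x : ∀ i, (A.obj i).V, (∀ {i j : I} (h : i ≤ j), (A.map h).onV (x j) = x i) →
    ∃! v : Γ.V, ∀ i, (π i).onV v = x i
  existsUnique_E : ∀ x : ∀ i, (A.obj i).E, (∀ {i j : I} (h : i ≤ j), (A.map h).onE (x j) = x i) →
    ∃! e : Γ.E, ∀ i, (π i).onE e = x i

/-- `f : Γ → Δ`, with projections `φ i` and `ψ i`, is the inverse limit of the inverse system of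
maps of finite discrete graphs `F`. -/
structure IsLimitMap {I : Type u} [Preorder I] {A B : System I} (F : SystemMap A B)
    {Γ Δ : ProfiniteGraph.{u}} (f : Map Γ Δ)
    (φ : ∀ i, SerreGraph.Hom Γ.toSerreGraph (A.obj i))
    (ψ : ∀ i, SerreGraph.Hom Δ.toSerreGraph (B.obj i)) : Prop where
  isLimit_source : IsLimit A Γ φ
  isLimit_target : IsLimit B Δ ψ
  comm : ∀ i, (F.app i).comp (φ i) = (ψ i).comp f.toHom

/-- `f` is a covering of profinite graphs: an inverse limit, over a directed set, of locally
bijective maps of finite discrete graphs. -/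
def Map.IsCovering {Γ Δ : ProfiniteGraph.{u}} (f : Map Γ Δ) : Prop :=
  ∃ (I : Type u) (_ : Preorder I) (_ : Nonempty I) (_ : IsDirectedOrder I)
    (A B : System I) (F : SystemMap A B)
    (φ : ∀ i, SerreGraph.Hom Γ.toSerreGraph (A.obj i))
    (ψ : ∀ i, SerreGraph.Hom Δ.toSerreGraph (B.obj i)),
    A.IsFinite ∧ B.IsFinite ∧ (∀ i, (F.app i).LocallyBijective) ∧ IsLimitMap F f φ ψ

/-- `f` is a regular covering of profinite graphs: an inverse limit, over a directed set, of regular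
coverings of path connected finite discrete graphs. -/
def Map.IsRegularCovering {Γ Δ : ProfiniteGraph.{u}} (f : Map Γ Δ) : Prop :=
  ∃ (I : Type u) (_ : Preorder I) (_ : Nonempty I) (_ : IsDirectedOrder I)
    (A B : System I) (F : SystemMap A B)
    (φ : ∀ i, SerreGraph.Hom Γ.toSerreGraph (A.obj i))
    (ψ : ∀ i, SerreGraph.Hom Δ.toSerreGraph (B.obj i)),
    A.IsFinite ∧ B.IsFinite ∧ (∀ i, (F.app i).IsRegularCovering) ∧ IsLimitMap F f φ ψ

/-- `h` is a homomorphism of coverings from `(Γ₁, f₁)` to `(Γ₂, f₂)`. -/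
def IsCoveringHom {Γ₁ Γ₂ Δ : ProfiniteGraph.{u}} (f₁ : Map Γ₁ Δ) (f₂ : Map Γ₂ Δ) (h : Map Γ₁ Γ₂) :
    Prop :=
  f₂.toHom.comp h.toHom = f₁.toHom

/-- `(D, p)` is a universal profinite covering graph of `Δ`. -/
def IsUniversalCovering {D Δ : ProfiniteGraph.{u}} (p : Map D Δ) : Prop :=
  D.IsConnected ∧ p.IsCovering ∧
    ∀ (Γ : ProfiniteGraph.{u}) (f : Map Γ Δ), Γ.IsConnected → f.IsCovering →
      ∀ (c : D.V) (a : Γ.V), p.onV c = f.onV a →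
        ∃ h : Map D Γ, IsCoveringHom p f h ∧ h.onV c = a

/-! ### The system of finite quotients and finite-index normal subgroups -/

/-- Pairs `(S, N)` of a compatible cofinite entourage `S` of `Δ` and a normal subgroup `N` of finite
index in `π₁(Δ / S, S[b])`. -/
structure CoverIndex (Δ : ProfiniteGraph.{u}) (b : Δ.V) : Type u where
  rel : Δ.toSerreGraph.CompatRel
  isCofiniteEntourage : Δ.IsCofiniteEntourage rel
  N : Subgroup ((Δ.toSerreGraph.quot rel).Pi1 ((Δ.toSerreGraph.proj rel).onV b))
  normal : N.Normal
  finiteIndex : N.FiniteIndex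

/-- `(S, N) ≤ (P, M)` if `P ⊆ S` and the natural map `Δ / P → Δ / S` carries `M` into `N`. -/
instance (Δ : ProfiniteGraph.{u}) (b : Δ.V) : Preorder (CoverIndex Δ b) where
  le i j := ∃ h : j.rel.Finer i.rel,
    ∀ x ∈ j.N, pi1Map (quotMap h) (a := (Δ.toSerreGraph.proj j.rel).onV b)
      (b := (Δ.toSerreGraph.proj i.rel).onV b) rfl x ∈ i.N
  le_refl i := by
    refine ⟨⟨le_refl _, le_refl _⟩, ?_⟩
    rintro ⟨l, hl⟩ hx
    refine (congrArg (· ∈ i.N) ?_).mpr hx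
    refine congrArg (Quot.mk _) (Subtype.ext ?_)
    refine (List.map_congr_left ?_).trans (List.map_id l)
    rintro ⟨e⟩ _
    rfl
  le_trans i j k := by
    rintro ⟨h₁, H₁⟩ ⟨h₂, H₂⟩
    refine ⟨⟨h₂.1.trans h₁.1, h₂.2.trans h₁.2⟩, ?_⟩
    intro x hx
    convert H₁ _ (H₂ x hx) using 1
    obtain ⟨l, hl⟩ := x
    refine congrArg (Quot.mk _) (Subtype.ext ?_)
    refine Eq.trans (List.map_congr_left ?_) List.map_map.symm
    rintro ⟨e⟩ _
    rfl

/-- The inverse system of the finite quotient graphs `Δ / S`, indexed by the pairs `(S, N)`. -/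
def quotSystem (Δ : ProfiniteGraph.{u}) (b : Δ.V) : System (CoverIndex Δ b) where
  obj j := Δ.toSerreGraph.quot j.rel
  map h := quotMap h.1
  map_refl i := by
    apply SerreGraph.Hom.ext <;> (funext x; obtain ⟨x⟩ := x; rfl)
  map_trans hij hjk := by
    apply SerreGraph.Hom.ext <;> (funext x; obtain ⟨x⟩ := x; rfl)

/-- With `b = p c`, the map `p` is the inverse limit of the system of finite regular coverings
`F (S, N) : (Γ (S, N), a (S, N)) → (Δ / S, S[b])` that correspond to the finite-index normal
subgroups `N` of `π₁(Δ / S, S[b])`, for all compatible cofinite entourages `S` of `Δ`; the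
transition maps preserve the base points, and `c` is the vertex given by the base points. -/
def IsLimitOfNormalCovers {D Δ : ProfiniteGraph.{u}} (p : Map D Δ) (c : D.V) : Prop :=
  Nonempty (CoverIndex Δ (p.onV c)) ∧ IsDirectedOrder (CoverIndex Δ (p.onV c)) ∧
  ∃ (A : System (CoverIndex Δ (p.onV c))) (F : SystemMap A (quotSystem Δ (p.onV c)))
    (φ : ∀ j, SerreGraph.Hom D.toSerreGraph (A.obj j))
    (a : ∀ j, (A.obj j).V)
    (ha : ∀ j, (F.app j).onV (a j) = (Δ.toSerreGraph.proj j.rel).onV (p.onV c)),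
    A.IsFinite ∧ (∀ j, (F.app j).IsRegularCovering) ∧
    (∀ j, (pi1Map (H := Δ.toSerreGraph.quot j.rel) (F.app j) (ha j)).range = j.N) ∧
    (∀ {i j} (h : i ≤ j), (A.map h).onV (a j) = a i) ∧
    (∀ j, (φ j).onV c = a j) ∧
    IsLimitMap F p φ (fun j => Δ.toSerreGraph.proj j.rel)

end ProfiniteGraph

/-!
The universal covering of `Δ` is the limit of the finite normal coverings of its finite quotients.
What makes it universal is a lifting property (`HasFiniteLifting`): composed with any continuous
map from `Δ` to a discrete graph, the projection lifts through every locally bijective map with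
finite source, with prescribed value at a vertex. The theorem is a formal consequence of this
property and of the uniqueness of lifts on connected graphs.

For abstract graphs, a map from a path connected graph lifts through a locally bijective map
whenever closed walks lift to closed walks (`Hom.LocallyBijective.exists_lift`). The finite regular
covering belonging to a normal subgroup `N` of `π₁(G, b)` of finite index is derived from a voltage
assignment with values in `π₁(G, b) / N` (`exists_normalCover`), which makes its covering
transformations visible as left multiplications. By the lifting criterion these coverings of the
quotients `Δ / S` form an inverse system in a unique way compatible with base points; the limit
exists by compactness (`IsConnected.exists_isLimitOfNormalCovers`).

The transition maps of this system need not be surjective. Still, a continuous map from a limit of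
finite graphs to a discrete graph factors through one of them (`IsLimit.exists_factor`), so the
limit is connected. It has the lifting property because the monodromy of a finite covering of a
finite quotient of `Δ` is trivial on a normal subgroup of finite index
(`IsLimitOfNormalCovers.hasFiniteLifting`). Lifting to each approximation of a profinite covering
and gluing by uniqueness gives universality.

Conversely, a universal covering `p : D → Δ` maps to that limit and so has the lifting property. If
`p = g ∘ h` with a covering `g : T → Δ`, then `h` has the lifting property too, by a fiber product
argument (`HasFiniteLifting.of_comp`). The same property over `T` of the limit `D'` of the finite
normal coverings of `T` then gives mutually inverse maps between `D` and `D'` over `T`, so `h` is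
such a limit and therefore regular (`IsUniversalCovering.isLimitOfNormalCovers`). The statements
about `p` itself are the case `T = Δ`, `g = id`.
-/

namespace SerreGraph

variable {G H K : SerreGraph.{u}}

/-! ### Walks and their lifts -/

theorem isWalk_append {l₁ l₂ : List G.E} : ∀ {u w : G.V}, G.IsWalk u (l₁ ++ l₂) w ↔
    ∃ v, G.IsWalk u l₁ v ∧ G.IsWalk v l₂ w := by
  induction l₁ with
  | nil => intro u w; simp [IsWalk]
  | cons e l ih => intro u w; simp [IsWalk, ih, and_assoc]

theorem IsWalk.end_unique {l : List G.E} : ∀ {u v w : G.V}, G.IsWalk u l v → G.IsWalk u l w →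
    v = w := by
  induction l with
  | nil => intro u v w h₁ h₂; exact Eq.trans (Eq.symm h₁) h₂
  | cons e l ih => intro u v w h₁ h₂; exact ih h₁.2 h₂.2

/-- The walk `l` traversed backwards. -/
def rev (G : SerreGraph.{u}) (l : List G.E) : List G.E := (l.map G.inv).reverse

theorem IsWalk.rev {l : List G.E} {u v : G.V} (h : G.IsWalk u l v) : G.IsWalk v (G.rev l) u :=
  h.reverse

theorem rev_rev (l : List G.E) : G.rev (G.rev l) = l := by
  simp [SerreGraph.rev, Function.comp_def, G.inv_inv]

theorem rev_append (l₁ l₂ : List G.E) : G.rev (l₁ ++ l₂) = G.rev l₂ ++ G.rev l₁ := by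
  simp [SerreGraph.rev]

theorem rev_cons (e : G.E) (l : List G.E) : G.rev (e :: l) = G.rev l ++ [G.inv e] := by
  simp [SerreGraph.rev]

theorem Hom.map_rev (f : Hom G H) (l : List G.E) :
    (G.rev l).map f.onE = H.rev (l.map f.onE) := by
  simp [SerreGraph.rev, Function.comp_def, f.inv_comm]

/-- Existence of lifts of walks through a locally bijective map. -/
theorem Hom.LocallyBijective.exists_walk {f : Hom K H} (hf : f.LocallyBijective) {l : List H.E} :
    ∀ {w : K.V} {v : H.V}, H.IsWalk (f.onV w) l v →
      ∃ l' w', K.IsWalk w l' w' ∧ l'.map f.onE = l := by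
  induction l with
  | nil => intro w v _; exact ⟨[], w, rfl, rfl⟩
  | cons e l ih =>
    intro w v h
    obtain ⟨e', ⟨he', hfe⟩, -⟩ := hf w e h.1
    have h2 : H.IsWalk (f.onV (K.tgt e')) l v := by
      rw [← f.tgt_comm, hfe]
      exact h.2
    obtain ⟨l', w', hl', hm⟩ := ih h2
    exact ⟨e' :: l', w', ⟨he', hl'⟩, by simp [hfe, hm]⟩

theorem Hom.LocallyBijective.edge_unique {f : Hom K H} (hf : f.LocallyBijective) {e e' : K.E}
    (hs : K.src e = K.src e') (h : f.onE e = f.onE e') : e = e' :=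
  (hf (K.src e') (f.onE e') (f.src_comm e')).unique ⟨hs, h⟩ ⟨rfl, rfl⟩

/-- Uniqueness of lifts of walks through a locally bijective map. -/
theorem Hom.LocallyBijective.walk_unique {f : Hom K H} (hf : f.LocallyBijective) {l : List K.E} :
    ∀ {l' : List K.E} {w v v' : K.V}, K.IsWalk w l v → K.IsWalk w l' v' →
      l.map f.onE = l'.map f.onE → v = v' := by
  induction l with
  | nil =>
    intro l' w v v' h h' hm
    cases l' with
    | nil => exact h.end_unique h'
    | cons e' l' => simp at hm
  | cons e l ih =>
    intro l' w v v' h h' hm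
    cases l' with
    | nil => simp at hm
    | cons e' l' =>
      simp only [List.map_cons, List.cons.injEq] at hm
      obtain rfl := hf.edge_unique (h.1.trans h'.1.symm) hm.1
      exact ih h.2 h'.2 hm.2

theorem Hom.LocallyBijective.comp {f : Hom H K} {g : Hom G H} (hf : f.LocallyBijective)
    (hg : g.LocallyBijective) : (f.comp g).LocallyBijective := by
  intro v e' he'
  obtain ⟨e₁, ⟨h₁, h₁'⟩, -⟩ := hf (g.onV v) e' he'
  obtain ⟨e₂, ⟨h₂, h₂'⟩, -⟩ := hg v e₁ h₁
  refine ⟨e₂, ⟨h₂, (congrArg f.onE h₂').trans h₁'⟩, ?_⟩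
  rintro e ⟨he, hfe⟩
  refine hg.edge_unique (he.trans h₂.symm) (hf.edge_unique ?_ ?_)
  · rw [g.src_comm, g.src_comm, he, h₂]
  · exact hfe.trans (h₁'.symm.trans (congrArg f.onE h₂'.symm))

theorem Hom.onV_congr {f g : Hom G H} (h : f = g) (v : G.V) : f.onV v = g.onV v := by rw [h]

theorem Hom.onE_congr {f g : Hom G H} (h : f = g) (e : G.E) : f.onE e = g.onE e := by rw [h]

/-- Two lifts of a map from a path connected graph that agree at a vertex are equal. -/
theorem Hom.LocallyBijective.lift_unique {f : Hom K H} (hf : f.LocallyBijective)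
    (hG : G.PathConnected) {h h' : Hom G K} (hc : f.comp h = f.comp h') {v : G.V}
    (hv : h.onV v = h'.onV v) : h = h' := by
  have hV : ∀ w, h.onV w = h'.onV w := by
    intro w
    obtain ⟨l, hl⟩ := hG.2 v w
    refine hf.walk_unique (hl.map h) (hv ▸ hl.map h') ?_
    simp only [List.map_map]
    exact List.map_congr_left fun e _ => Hom.onE_congr hc e
  refine Hom.ext (funext hV) (funext fun e => hf.edge_unique ?_ (Hom.onE_congr hc e))
  rw [h.src_comm, h'.src_comm, hV]

/-- The lifting criterion: a map `q` from a path connected graph lifts through a locally bijective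
map `f` as soon as the lifts of the images of closed walks at the base point are closed. -/
theorem Hom.LocallyBijective.exists_lift {q : Hom G H} {f : Hom K H} (hf : f.LocallyBijective)
    (hG : G.PathConnected) {v₀ : G.V} {w₀ : K.V} (h₀ : q.onV v₀ = f.onV w₀)
    (hcl : ∀ l l' w', G.IsWalk v₀ l v₀ → K.IsWalk w₀ l' w' → l'.map f.onE = l.map q.onE →
      w' = w₀) :
    ∃ h : Hom G K, f.comp h = q ∧ h.onV v₀ = w₀ := by
  -- `R v w`: some walk from `v₀` to `v` and some walk from `w₀` to `w` have the same image.
  let R : G.V → K.V → Prop := fun v w => ∃ l l', G.IsWalk v₀ l v ∧ K.IsWalk w₀ l' w ∧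
    l'.map f.onE = l.map q.onE
  have hRq : ∀ {v w}, R v w → f.onV w = q.onV v := by
    rintro v w ⟨l, l', hl, hl', hm⟩
    have h1 := hl'.map f
    rw [hm, ← h₀] at h1
    exact h1.end_unique (hl.map q)
  have hRex : ∀ v, ∃ w, R v w := by
    intro v
    obtain ⟨l, hl⟩ := hG.2 v₀ v
    have h1 := hl.map q
    rw [h₀] at h1
    obtain ⟨l', w', hl', hm⟩ := hf.exists_walk h1
    exact ⟨w', l, l', hl, hl', hm⟩
  have hRu : ∀ {v w w'}, R v w → R v w' → w = w' := by
    rintro v w₁ w₂ h1 ⟨l₂, l₂', hl₂, hl₂', hm₂⟩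
    have hq := hRq h1
    obtain ⟨l₁, l₁', hl₁, hl₁', hm₁⟩ := h1
    have h2 := hl₂.rev.map q
    rw [← hq] at h2
    obtain ⟨m, w', hm, hmm⟩ := hf.exists_walk h2
    obtain rfl : w' = w₀ := hcl (l₁ ++ G.rev l₂) (l₁' ++ m) w' (hl₁.append hl₂.rev)
      (hl₁'.append hm) (by simp [hm₁, hmm])
    refine hf.walk_unique hm.rev hl₂' ?_
    rw [f.map_rev, hmm, q.map_rev, rev_rev, hm₂]
  have hRe : ∀ {v w} (e' : K.E) (e : G.E), R v w → K.src e' = w → G.src e = v →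
      f.onE e' = q.onE e → R (G.tgt e) (K.tgt e') := by
    rintro v w e' e ⟨l, l', hl, hl', hm⟩ h1 h2 h3
    exact ⟨l ++ [e], l' ++ [e'], hl.append ⟨h2, rfl⟩, hl'.append ⟨h1, rfl⟩, by simp [hm, h3]⟩
  choose hV hhV using hRex
  have hE : ∀ e : G.E, ∃ e' : K.E, K.src e' = hV (G.src e) ∧ f.onE e' = q.onE e := by
    intro e
    exact (hf (hV (G.src e)) (q.onE e) (by rw [hRq (hhV _), q.src_comm])).exists
  choose hE hhE using hE
  have htgt : ∀ e, K.tgt (hE e) = hV (G.tgt e) := fun e =>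
    hRu (hRe (hE e) e (hhV _) (hhE e).1 rfl (hhE e).2) (hhV _)
  refine ⟨⟨hV, hE, fun e => (hhE e).1, htgt, fun e => ?_⟩, ?_, ?_⟩
  · refine hf.edge_unique ?_ ?_
    · rw [K.src_inv, htgt, (hhE _).1, G.src_inv]
    · rw [← f.inv_comm, (hhE _).2, (hhE _).2, q.inv_comm]
  · exact Hom.ext (funext fun v => hRq (hhV v)) (funext fun e => (hhE e).2)
  · exact hRu (hhV v₀) ⟨[], [], rfl, rfl, rfl⟩

/-! ### Voltages -/

section Voltage

variable {M : Type u} [Group M] {γ : G.E → M}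

theorem prod_voltage_rev (hγ : ∀ e, γ (G.inv e) = (γ e)⁻¹) (l : List G.E) :
    ((G.rev l).map γ).prod = ((l.map γ).prod)⁻¹ := by
  induction l with
  | nil => simp [rev]
  | cons e l ih => simp [rev_cons, ih, hγ]

/-- A voltage assignment `γ`, with values in a group and `γ (inv e) = (γ e)⁻¹`, extends
multiplicatively to walks and so to the fundamental group. -/
def voltageHom (hγ : ∀ e, γ (G.inv e) = (γ e)⁻¹) (b : G.V) : G.Pi1 b →* M where
  toFun := Quot.lift (fun p => (p.1.map γ).prod) (by
    rintro p q ⟨l₁, e, l₂, hp, hq⟩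
    simp [hp, hq, hγ])
  map_one' := rfl
  map_mul' := by
    rintro ⟨p⟩ ⟨q⟩
    change ((p.1 ++ q.1).map γ).prod = (p.1.map γ).prod * (q.1.map γ).prod
    simp

/-- The covering graph of `G` derived from a voltage assignment `γ` with values in the group `M`:
traversing a lift of the edge `e` multiplies the `M`-coordinate by `γ e` on the right. -/
def voltageCover (hγ : ∀ e, γ (G.inv e) = (γ e)⁻¹) : SerreGraph.{u} where
  V := G.V × M
  E := G.E × M
  src x := (G.src x.1, x.2)
  tgt x := (G.tgt x.1, x.2 * γ x.1)
  inv x := (G.inv x.1, x.2 * γ x.1)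
  inv_inv x := by simp [hγ, G.inv_inv]
  inv_ne x h := G.inv_ne x.1 (congrArg Prod.fst h)
  src_inv x := by simp [G.src_inv]
  tgt_inv x := by simp [hγ, G.tgt_inv]

/-- The projection of the derived graph. -/
def voltageProj (hγ : ∀ e, γ (G.inv e) = (γ e)⁻¹) : Hom (voltageCover hγ) G where
  onV := Prod.fst
  onE := Prod.fst
  src_comm _ := rfl
  tgt_comm _ := rfl
  inv_comm _ := rfl

/-- Left multiplication on the `M`-coordinate commutes with the right multiplications by voltages,
so it is a covering transformation of the derived graph. -/
def voltageDeck (hγ : ∀ e, γ (G.inv e) = (γ e)⁻¹) (m : M) :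
    Hom (voltageCover hγ) (voltageCover hγ) where
  onV x := (x.1, m * x.2)
  onE x := (x.1, m * x.2)
  src_comm _ := rfl
  tgt_comm _ := Prod.ext rfl (mul_assoc _ _ _)
  inv_comm _ := Prod.ext rfl (mul_assoc _ _ _)

theorem voltageProj_locallyBijective (hγ : ∀ e, γ (G.inv e) = (γ e)⁻¹) :
    (voltageProj hγ).LocallyBijective := by
  rintro ⟨v, m⟩ e he
  refine ⟨(e, m), ⟨Prod.ext he rfl, rfl⟩, ?_⟩
  rintro ⟨e', m'⟩ ⟨h1, h2⟩
  obtain rfl : e' = e := h2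
  obtain rfl : m' = m := congrArg Prod.snd h1
  rfl

theorem IsWalk.voltage_eq (hγ : ∀ e, γ (G.inv e) = (γ e)⁻¹) {l : List (voltageCover hγ).E} :
    ∀ {x y : (voltageCover hγ).V}, (voltageCover hγ).IsWalk x l y →
      y.2 = x.2 * ((l.map (voltageProj hγ).onE).map γ).prod := by
  induction l with
  | nil => intro x y h; obtain rfl : x = y := h; simp
  | cons e l ih =>
    intro x y h
    obtain ⟨rfl, h2⟩ := h
    rw [ih h2]
    change (e.2 * γ e.1) * _ = e.2 * (List.map γ (e.1 :: _)).prod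
    rw [List.map_cons, List.prod_cons, mul_assoc]

theorem exists_walk_voltageCover (hγ : ∀ e, γ (G.inv e) = (γ e)⁻¹) {l : List G.E} {u v : G.V}
    (h : G.IsWalk u l v) (m : M) :
    ∃ l', (voltageCover hγ).IsWalk (u, m) l' (v, m * (l.map γ).prod) ∧
      l'.map (voltageProj hγ).onE = l := by
  obtain ⟨l', w', hl', hm⟩ := (voltageProj_locallyBijective hγ).exists_walk (w := (u, m)) h
  have hw : w' = (v, m * (l.map γ).prod) := by
    refine Prod.ext ?_ ?_
    · have h1 := hl'.map (voltageProj hγ)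
      rw [hm] at h1
      exact h1.end_unique h
    · rw [hl'.voltage_eq, hm]
  exact ⟨l', hw ▸ hl', hm⟩

theorem voltageCover_pathConnected (hγ : ∀ e, γ (G.inv e) = (γ e)⁻¹) (hG : G.PathConnected)
    {b : G.V} (hs : Function.Surjective (voltageHom hγ b)) : (voltageCover hγ).PathConnected := by
  refine ⟨⟨(b, 1)⟩, ?_⟩
  rintro ⟨u, x⟩ ⟨v, y⟩
  obtain ⟨l₁, h₁⟩ := hG.2 u b
  obtain ⟨l₂, h₂⟩ := hG.2 b v
  obtain ⟨⟨⟨l, hl⟩⟩, hp⟩ := hs (((l₁.map γ).prod)⁻¹ * x⁻¹ * y * ((l₂.map γ).prod)⁻¹)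
  change (l.map γ).prod = _ at hp
  obtain ⟨l', hl', -⟩ := exists_walk_voltageCover hγ ((h₁.append hl).append h₂) x
  refine ⟨l', ?_⟩
  convert hl'
  simp only [List.map_append, List.prod_append, hp]
  group

theorem voltageProj_isRegularCovering (hγ : ∀ e, γ (G.inv e) = (γ e)⁻¹) (hG : G.PathConnected)
    {b : G.V} (hs : Function.Surjective (voltageHom hγ b)) :
    (voltageProj hγ).IsRegularCovering := by
  refine ⟨voltageCover_pathConnected hγ hG hs, hG, voltageProj_locallyBijective hγ, ?_⟩
  rintro ⟨v, x⟩ ⟨v', y⟩ (rfl : v = v')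
  have key : ∀ m : M, (voltageDeck hγ m).comp (voltageDeck hγ m⁻¹) = Hom.id _ := fun m =>
    Hom.ext (funext fun z => Prod.ext rfl (mul_inv_cancel_left m z.2))
      (funext fun z => Prod.ext rfl (mul_inv_cancel_left m z.2))
  refine ⟨voltageDeck hγ (y * x⁻¹), voltageDeck hγ (y * x⁻¹)⁻¹, key _, ?_, rfl, ?_⟩
  · simpa using key (y * x⁻¹)⁻¹
  · exact Prod.ext rfl (inv_mul_cancel_right y x)

end Voltage

/-! ### The finite covering attached to a normal subgroup -/

/-- Inserting a backtracking walk does not change the homotopy class. -/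
theorem pathClass_cancel {l : List G.E} : ∀ {u v : G.V} {l₁ l₂ : List G.E}
    (h : G.IsWalk u (l₁ ++ (G.rev l ++ l) ++ l₂) v) (h' : G.IsWalk u (l₁ ++ l₂) v),
    (Quot.mk WalkStep ⟨_, h⟩ : G.PathClass u v) = Quot.mk WalkStep ⟨_, h'⟩ := by
  induction l with
  | nil => intro u v l₁ l₂ h h'; exact congrArg (Quot.mk _) (Subtype.ext (by simp [rev]))
  | cons e l ih =>
    intro u v l₁ l₂ h h'
    have h2 : G.IsWalk u (l₁ ++ (G.rev l ++ l) ++ l₂) v := by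
      simp only [rev_cons, List.append_assoc, List.cons_append, List.nil_append,
        isWalk_append, IsWalk, G.src_inv, G.tgt_inv] at h ⊢
      obtain ⟨v₁, h₁, v₂, h₂, h₃, -, h₄⟩ := h
      exact ⟨v₁, h₁, v₂, h₂, h₃ ▸ h₄⟩
    rw [← ih h2 h']
    refine Quot.sound ⟨l₁ ++ G.rev l, G.inv e, l ++ l₂, ?_, ?_⟩
    · simp [rev_cons, G.inv_inv]
    · simp

/-- The finite regular covering of a path connected finite graph that corresponds to a normal
subgroup `N` of finite index of its fundamental group. It is derived from the voltages
`e ↦ [t (src e) · e · t (tgt e)⁻¹]` in `π₁(G, b) / N`, where `t v` is a chosen walk from `b`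
to `v`. -/
theorem exists_normalCover (hG : G.PathConnected) (hV : Finite G.V) (hE : Finite G.E) (b : G.V)
    (N : Subgroup (G.Pi1 b)) (hN : N.Normal) (hfin : N.FiniteIndex) :
    ∃ (A : SerreGraph.{u}) (F : Hom A G) (a : A.V) (ha : F.onV a = b),
      Finite A.V ∧ Finite A.E ∧ F.IsRegularCovering ∧ (pi1Map F ha).range = N := by
  choose t ht using hG.2 b
  let γ₀ : G.E → G.Pi1 b := fun e => Quot.mk _ ⟨t (G.src e) ++ [e] ++ G.rev (t (G.tgt e)),
    ((ht _).append (v := G.src e) (l₂ := [e]) (w := G.tgt e) ⟨rfl, rfl⟩).append (ht _).rev⟩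
  have hγ₀ : ∀ e, γ₀ (G.inv e) = (γ₀ e)⁻¹ := by
    intro e
    refine congrArg (Quot.mk _) (Subtype.ext ?_)
    change _ = G.rev (t (G.src e) ++ [e] ++ G.rev (t (G.tgt e)))
    simp [rev_append, rev_rev, rev_cons, G.src_inv, G.tgt_inv]
  have hprod : ∀ {l : List G.E} {u v : G.V} (hl : G.IsWalk u l v), (l.map γ₀).prod =
      (Quot.mk _ ⟨t u ++ l ++ G.rev (t v), ((ht u).append hl).append (ht v).rev⟩ : G.Pi1 b) := by
    intro l
    induction l with
    | nil =>
      rintro u v (rfl : u = v)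
      have h := ((ht u).append (l₂ := []) rfl).append (ht u).rev
      have := pathClass_cancel (l := G.rev (t u)) (l₁ := []) (l₂ := [])
        (by simpa [rev_rev] using h) rfl
      refine Eq.trans this.symm (congrArg (Quot.mk _) (Subtype.ext ?_))
      simp [rev_rev]
    | cons e l ih =>
      rintro u v ⟨rfl, hl⟩
      rw [List.map_cons, List.prod_cons, ih hl]
      have := pathClass_cancel (l := t (G.tgt e)) (l₁ := t (G.src e) ++ [e])
        (l₂ := l ++ G.rev (t v))
        (by
          have := (((ht (G.src e)).append (l₂ := [e]) ⟨rfl, rfl⟩).append (ht _).rev).append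
            (((ht _).append hl).append (ht v).rev)
          simpa using this)
        (by
          have := (((ht (G.src e)).append (l₂ := [e]) ⟨rfl, rfl⟩).append hl).append (ht v).rev
          simpa using this)
      refine Eq.trans (congrArg (Quot.mk _) (Subtype.ext ?_))
        (this.trans (congrArg (Quot.mk _) (Subtype.ext ?_)))
      · simp
      · simp
  let τ : G.Pi1 b := Quot.mk _ ⟨t b, ht b⟩
  have hconj : ∀ x, voltageHom hγ₀ b x = τ * x * τ⁻¹ := by
    rintro ⟨l, hl⟩
    exact hprod hl
  let γ : G.E → G.Pi1 b ⧸ N := fun e => QuotientGroup.mk' N (γ₀ e)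
  have hγ : ∀ e, γ (G.inv e) = (γ e)⁻¹ := fun e => by simp only [γ, hγ₀, map_inv]
  have hvol : ∀ x, voltageHom hγ b x = QuotientGroup.mk' N (τ * x * τ⁻¹) := by
    intro x
    rw [← hconj]
    obtain ⟨l, hl⟩ := x
    change (l.map γ).prod = QuotientGroup.mk' N (l.map γ₀).prod
    rw [map_list_prod, List.map_map]
    rfl
  have hker : ∀ x, voltageHom hγ b x = 1 ↔ x ∈ N := by
    intro x
    rw [hvol, QuotientGroup.mk'_apply, QuotientGroup.eq_one_iff]
    refine ⟨fun h => ?_, fun h => hN.conj_mem x h τ⟩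
    simpa [mul_assoc] using hN.conj_mem _ h τ⁻¹
  have hs : Function.Surjective (voltageHom hγ b) := by
    intro y
    obtain ⟨x, rfl⟩ := QuotientGroup.mk'_surjective N y
    exact ⟨τ⁻¹ * x * τ, by rw [hvol]; congr 1; group⟩
  have : Finite (G.Pi1 b ⧸ N) := Subgroup.finite_quotient_of_finiteIndex
  refine ⟨voltageCover hγ, voltageProj hγ, (b, 1), rfl, ?_, ?_,
    voltageProj_isRegularCovering hγ hG hs, ?_⟩
  · exact inferInstanceAs (Finite (G.V × (G.Pi1 b ⧸ N)))
  · exact inferInstanceAs (Finite (G.E × (G.Pi1 b ⧸ N)))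
  · ext x
    rw [← hker]
    constructor
    · rintro ⟨⟨⟨l, hl⟩⟩, rfl⟩
      have := hl.voltage_eq
      rw [one_mul] at this
      exact this.symm
    · obtain ⟨l, hl⟩ := x
      intro hx
      change (l.map γ).prod = 1 at hx
      obtain ⟨l', hl', hm⟩ := exists_walk_voltageCover hγ hl 1
      rw [hx, one_mul] at hl'
      exact ⟨Quot.mk _ ⟨l', hl'⟩, congrArg (Quot.mk _) (Subtype.ext hm)⟩

/-! ### Monodromy -/

/-- The monodromy of a locally bijective map, extended to permutations of the whole vertex set: an
edge `e` of `H` exchanges the two fibers over its ends along the lifts of `e` (or permutes the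
single fiber, if `e` is a loop) and fixes the other vertices. -/
theorem Hom.LocallyBijective.exists_monodromy {f : Hom K H} (hf : f.LocallyBijective) :
    ∃ σ : H.E → Equiv.Perm K.V, (∀ e, σ (H.inv e) = (σ e)⁻¹) ∧
      ∀ e, σ (f.onE e) (K.tgt e) = K.src e := by
  classical
  have h1 : ∀ (w : K.V) (e : H.E), ∃ w', ∀ e', K.src e' = w → f.onE e' = e → K.tgt e' = w' := by
    intro w e
    by_cases h : H.src e = f.onV w
    · obtain ⟨e₁, he₁, hu⟩ := hf w e h
      exact ⟨K.tgt e₁, fun e' h1 h2 => by rw [hu e' ⟨h1, h2⟩]⟩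
    · refine ⟨w, fun e' h1 h2 => absurd ?_ h⟩
      rw [← h2, ← h1, f.src_comm]
  choose s hs using h1
  have hs1 : ∀ w e, H.src e = f.onV w → f.onV (s w e) = H.tgt e ∧ s (s w e) (H.inv e) = w := by
    intro w e h
    obtain ⟨e₁, ⟨he₁, he₁'⟩, -⟩ := hf w e h
    rw [← hs w e e₁ he₁ he₁', ← f.tgt_comm, he₁']
    refine ⟨rfl, ?_⟩
    rw [← hs (K.tgt e₁) (H.inv e) (K.inv e₁) (K.src_inv e₁) (by rw [← f.inv_comm, he₁']),
      K.tgt_inv, he₁]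
  let T : H.E → K.V → K.V := fun e w =>
    if H.src e = f.onV w then s w e else if H.tgt e = f.onV w then s w (H.inv e) else w
  have hT : ∀ e w, T (H.inv e) (T e w) = w := by
    intro e w
    by_cases h : H.src e = f.onV w
    · have := hs1 w e h
      simp only [T, if_pos h, H.src_inv, this.1, if_true, this.2]
    · by_cases h2 : H.tgt e = f.onV w
      · have := hs1 w (H.inv e) (by rw [H.src_inv, h2])
        rw [H.tgt_inv, H.inv_inv] at this
        have h3 : H.tgt e ≠ H.src e := fun h3 => h (h3 ▸ h2)
        simp only [T, if_neg h, if_pos h2, H.src_inv, H.tgt_inv, this.1, if_neg h3, if_true,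
          H.inv_inv, this.2]
      · simp only [T, if_neg h, if_neg h2, H.src_inv, H.tgt_inv]
  refine ⟨fun e => ⟨T (H.inv e), T e, fun w => ?_, fun w => hT e w⟩, fun e => ?_, fun e => ?_⟩
  · have := hT (H.inv e) w
    rwa [H.inv_inv] at this
  · ext w
    change T (H.inv (H.inv e)) w = T e w
    rw [H.inv_inv]
  · change T (H.inv (f.onE e)) (K.tgt e) = K.src e
    have h : H.src (H.inv (f.onE e)) = f.onV (K.tgt e) := by rw [H.src_inv, f.tgt_comm]
    simp only [T, if_pos h]
    rw [← hs (K.tgt e) (H.inv (f.onE e)) (K.inv e) (K.src_inv e) (f.inv_comm e).symm, K.tgt_inv]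

theorem IsWalk.monodromy {f : Hom K H} {σ : H.E → Equiv.Perm K.V}
    (hσ : ∀ e, σ (f.onE e) (K.tgt e) = K.src e) {l : List K.E} :
    ∀ {w w' : K.V}, K.IsWalk w l w' → ((l.map f.onE).map σ).prod w' = w := by
  induction l with
  | nil => rintro w w' h; exact Eq.symm h
  | cons e l ih =>
    rintro w w' ⟨rfl, h⟩
    simp only [List.map_cons, List.prod_cons, Equiv.Perm.mul_apply, ih h, hσ]

/-- The lift of a closed walk is closed if its class lies in the image of the fundamental group of
the covering graph. -/
theorem Hom.LocallyBijective.closed_of_mem_range {f : Hom K H} (hf : f.LocallyBijective)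
    {w w' : K.V} {b : H.V} (hw : f.onV w = b) {l : List H.E} (hl : H.IsWalk b l b)
    (hx : (Quot.mk _ ⟨l, hl⟩ : H.Pi1 b) ∈ (pi1Map f hw).range) {l' : List K.E}
    (hl' : K.IsWalk w l' w') (hm : l'.map f.onE = l) : w' = w := by
  obtain ⟨σ, hσ, hσe⟩ := hf.exists_monodromy
  obtain ⟨⟨⟨m, hmw⟩⟩, hx⟩ := hx
  have h1 : ((m.map f.onE).map σ).prod = (l.map σ).prod := congrArg (voltageHom hσ b) hx
  have h2 := hmw.monodromy hσe
  have h3 := hl'.monodromy hσe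
  rw [hm, ← h1] at h3
  exact Equiv.injective _ (h3.trans h2.symm)

/-- The monodromy of a locally bijective map `f` with finite source, pulled back along `r`, is
trivial on a normal subgroup of finite index. -/
theorem Hom.LocallyBijective.exists_normal_subgroup {f : Hom K H} (hf : f.LocallyBijective)
    (hK : Finite K.V) (r : Hom G H) (b : G.V) :
    ∃ (σ : H.E → Equiv.Perm K.V) (M : Subgroup (G.Pi1 b)),
      (∀ e, σ (H.inv e) = (σ e)⁻¹) ∧ (∀ e, σ (f.onE e) (K.tgt e) = K.src e) ∧
      M.Normal ∧ M.FiniteIndex ∧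
      ∀ l (hl : G.IsWalk b l b), (Quot.mk _ ⟨l, hl⟩ : G.Pi1 b) ∈ M →
        ((l.map r.onE).map σ).prod = 1 := by
  obtain ⟨σ, hσ, hσe⟩ := hf.exists_monodromy
  have hσr : ∀ e, σ (r.onE (G.inv e)) = (σ (r.onE e))⁻¹ := fun e => by rw [← r.inv_comm, hσ]
  refine ⟨σ, (voltageHom (γ := fun e => σ (r.onE e)) hσr b).ker, hσ, hσe,
    inferInstance, inferInstance, fun l hl h => ?_⟩
  rw [List.map_map]
  exact h

end SerreGraph

/-! ### Compact spaces and inverse systems of finite sets -/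

section InverseSystems

open CategoryTheory in
/-- If the `j`-th coordinates of all compatible families of an inverse system of finite sets lie in
`S`, then already some transition map to the `j`-th set has its image in `S`. -/
theorem exists_transition_mem {I : Type u} [Preorder I] [IsDirectedOrder I] {A : I → Type u}
    (hA : ∀ i, Finite (A i)) (m : ∀ {i j : I}, i ≤ j → A j → A i)
    (m_refl : ∀ i x, m (le_refl i) x = x)
    (m_trans : ∀ {i j k : I} (hij : i ≤ j) (hjk : j ≤ k) x, m (hij.trans hjk) x = m hij (m hjk x))
    (j : I) (S : Set (A j))
    (hS : ∀ x : ∀ i, A i, (∀ {i k : I} (h : i ≤ k), m h (x k) = x i) → x j ∈ S) :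
    ∃ k, ∃ h : j ≤ k, ∀ y : A k, m h y ∈ S := by
  by_contra! hcon
  -- The elements that come from an element with image outside `S` form an inverse subsystem.
  let B : ∀ i, Set (A i) := fun i => {y | ∃ k, ∃ hi : i ≤ k, ∃ hj : j ≤ k, ∃ z : A k,
    m hj z ∉ S ∧ m hi z = y}
  have hB : ∀ {i i' : I} (h : i ≤ i') (y : A i'), y ∈ B i' → m h y ∈ B i := by
    rintro i i' h y ⟨k, hi, hj, z, hz, rfl⟩
    exact ⟨k, h.trans hi, hj, z, hz, m_trans _ _ _⟩
  let F : Iᵒᵖ ⥤ Type u :=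
    { obj := fun i => B i.unop
      map := fun {i i'} f => TypeCat.ofHom fun y => ⟨m (leOfHom f.unop) y.1, hB _ _ y.2⟩
      map_id := fun i => by ext y; exact m_refl _ _
      map_comp := fun f g => by ext y; exact m_trans _ _ _ }
  have hfin : ∀ i, Finite (F.obj i) := fun i =>
    haveI := hA i.unop
    inferInstanceAs (Finite (B i.unop))
  have hne : ∀ i, Nonempty (F.obj i) := by
    intro i
    obtain ⟨k, hi, hj⟩ := exists_ge_ge i.unop j
    obtain ⟨z, hz⟩ := hcon k hj
    exact ⟨⟨m hi z, k, hi, hj, z, hz, rfl⟩⟩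
  obtain ⟨x, hx⟩ := nonempty_sections_of_finite_inverse_system F
  have hxj := hS (fun i => (x (Opposite.op i)).1) fun {i k} h =>
    congrArg Subtype.val (hx (homOfLE h).op)
  obtain ⟨k, hi, hj, z, hz, hzx⟩ := (x (Opposite.op j)).2
  rw [← hzx] at hxj
  exact hz hxj

variable {I X : Type*} [TopologicalSpace X] {A : I → Type*} {π : ∀ i, X → A i}

theorem IsLocallyConstant.isOpen_setOf_eq {Y : Type*} {f : X → Y} (hf : IsLocallyConstant f) :
    IsOpen {p : X × X | f p.1 = f p.2} :=
  ((hf.comp_continuous continuous_fst).prodMk (hf.comp_continuous continuous_snd))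
    {p | p.1 = p.2}

theorem IsLocallyConstant.isClosed_setOf_eq {Y : Type*} {f : X → Y} (hf : IsLocallyConstant f) :
    IsClosed {p : X × X | f p.1 = f p.2} :=
  ⟨((hf.comp_continuous continuous_fst).prodMk (hf.comp_continuous continuous_snd))
    {p | p.1 ≠ p.2}⟩

/-- A locally constant map on a compact space factors, as a map of sets, through one of the maps of
a directed separating family of locally constant maps. -/
theorem IsLocallyConstant.exists_ker_le [CompactSpace X] [Preorder I] [Nonempty I]
    [IsDirectedOrder I] (hπ : ∀ i, IsLocallyConstant (π i))
    (hmono : ∀ {i j}, i ≤ j → ∀ x y, π j x = π j y → π i x = π i y)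
    (hsep : ∀ x y, (∀ i, π i x = π i y) → x = y) {Y : Type*} {q : X → Y}
    (hq : IsLocallyConstant q) : ∃ i, ∀ x y, π i x = π i y → q x = q y := by
  by_contra! hcon
  have hcl : ∀ i, IsClosed {p : X × X | π i p.1 = π i p.2 ∧ q p.1 ≠ q p.2} := fun i =>
    (hπ i).isClosed_setOf_eq.inter hq.isOpen_setOf_eq.isClosed_compl
  obtain ⟨⟨x, y⟩, hxy⟩ := IsCompact.nonempty_iInter_of_directed_nonempty_isCompact_isClosed
    (fun i => {p : X × X | π i p.1 = π i p.2 ∧ q p.1 ≠ q p.2})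
    (by
      intro i j
      obtain ⟨k, hi, hj⟩ := exists_ge_ge i j
      exact ⟨k, fun p hp => ⟨hmono hi _ _ hp.1, hp.2⟩, fun p hp => ⟨hmono hj _ _ hp.1, hp.2⟩⟩)
    (fun i => by
      obtain ⟨x, y, h, h'⟩ := hcon i
      exact ⟨(x, y), h, h'⟩)
    (fun i => (hcl i).isCompact) hcl
  rw [Set.mem_iInter] at hxy
  obtain ⟨i⟩ := ‹Nonempty I›
  exact (hxy i).2 (congrArg q (hsep x y fun i => (hxy i).1))

theorem continuous_of_isLocallyConstant_comp [CompactSpace X]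
    (hπ : ∀ i, IsLocallyConstant (π i)) (hsep : ∀ x y, (∀ i, π i x = π i y) → x = y)
    {Z : Type*} [TopologicalSpace Z] {f : Z → X} (hf : ∀ i, IsLocallyConstant (π i ∘ f)) :
    Continuous f := by
  let _ : ∀ i, TopologicalSpace (A i) := fun _ => ⊥
  have : ∀ i, DiscreteTopology (A i) := fun _ => ⟨rfl⟩
  have he : Topology.IsClosedEmbedding (fun x i => π i x) :=
    (continuous_pi fun i => (hπ i).continuous).isClosedEmbedding
      fun x y h => hsep x y fun i => congrFun h i
  rw [he.isInducing.continuous_iff]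
  exact continuous_pi fun i => (hf i).continuous

/-- A directed family of compatible locally constant surjections on a compact space hits every
compatible family. -/
theorem existsUnique_of_surjective_of_compact {I X : Type*} [TopologicalSpace X] [CompactSpace X]
    [Preorder I] [Nonempty I] [IsDirectedOrder I] {A : I → Type*}
    (m : ∀ {i j : I}, i ≤ j → A j → A i) {π : ∀ i, X → A i} (hπ : ∀ i, IsLocallyConstant (π i))
    (hcomm : ∀ {i j : I} (h : i ≤ j) x, m h (π j x) = π i x)
    (hsurj : ∀ i, Function.Surjective (π i)) (hsep : ∀ x y, (∀ i, π i x = π i y) → x = y)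
    (x : ∀ i, A i) (hx : ∀ {i j : I} (h : i ≤ j), m h (x j) = x i) :
    ∃! v, ∀ i, π i v = x i := by
  have hcl : ∀ i, IsClosed (π i ⁻¹' {x i}) := fun i => (hπ i).isClosed_fiber (x i)
  obtain ⟨v, hv⟩ := IsCompact.nonempty_iInter_of_directed_nonempty_isCompact_isClosed
    (fun i => π i ⁻¹' {x i})
    (by
      intro i j
      obtain ⟨k, hi, hj⟩ := exists_ge_ge i j
      refine ⟨k, fun v (hv : π k v = x k) => ?_, fun v (hv : π k v = x k) => ?_⟩
      · change π i v = x i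
        rw [← hcomm hi, hv, hx]
      · change π j v = x j
        rw [← hcomm hj, hv, hx])
    (fun i => hsurj i (x i)) (fun i => (hcl i).isCompact) hcl
  rw [Set.mem_iInter] at hv
  exact ⟨v, hv, fun w hw => hsep _ _ fun i => (hw i).trans (hv i).symm⟩

/-- The uniformity of a set of families of elements of discrete spaces. -/
@[reducible] def familyUniformSpace {I : Type*} {A : I → Type*} (S : Set (∀ i, A i)) :
    UniformSpace S :=
  @instUniformSpaceSubtype _ _ (@Pi.uniformSpace _ A fun _ => ⊥)

/-- The compatible families of an inverse system. -/
def compatibleFamilies {I : Type*} [Preorder I] {A : I → Type*}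
    (m : ∀ {i j : I}, i ≤ j → A j → A i) : Set (∀ i, A i) :=
  {x | ∀ i j (h : i ≤ j), m h (x j) = x i}

theorem isLocallyConstant_family {I : Type*} {A : I → Type*} (S : Set (∀ i, A i)) (i : I) :
    letI := familyUniformSpace S
    IsLocallyConstant fun x : S => x.1 i := by
  let _ : ∀ i, UniformSpace (A i) := fun _ => ⊥
  exact (IsLocallyConstant.iff_continuous _).2 ((continuous_apply i).comp continuous_subtype_val)

theorem t2Space_family {I : Type*} {A : I → Type*} (S : Set (∀ i, A i)) :
    letI := familyUniformSpace S
    T2Space S := by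
  let _ : ∀ i, UniformSpace (A i) := fun _ => ⊥
  exact inferInstanceAs (T2Space S)

variable {I : Type*} [Preorder I] {A : I → Type*} (m : ∀ {i j : I}, i ≤ j → A j → A i)

theorem compactSpace_compatibleFamilies (hA : ∀ i, Finite (A i)) :
    letI := familyUniformSpace (compatibleFamilies m)
    CompactSpace (compatibleFamilies m) := by
  let _ : ∀ i, UniformSpace (A i) := fun _ => ⊥
  refine isCompact_iff_compactSpace.mp (IsClosed.isCompact ?_)
  simp only [compatibleFamilies, Set.ofPred_forall]
  refine isClosed_iInter fun i => isClosed_iInter fun j => isClosed_iInter fun h => ?_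
  exact isClosed_eq ((continuous_of_discreteTopology (f := m h)).comp (continuous_apply j))
    (continuous_apply i)

theorem mem_uniformity_compatibleFamilies [Nonempty I] [IsDirectedOrder I]
    (W : Set (compatibleFamilies m × compatibleFamilies m)) :
    W ∈ @uniformity _ (familyUniformSpace (compatibleFamilies m)) ↔
      ∃ i, {p | p.1.1 i = p.2.1 i} ⊆ W := by
  let _ : ∀ i, UniformSpace (A i) := fun _ => ⊥
  have h : uniformity (compatibleFamilies m) = ⨅ i, Filter.principal
      {p : compatibleFamilies m × compatibleFamilies m | p.1.1 i = p.2.1 i} := by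
    rw [uniformity_subtype, Pi.uniformity, Filter.comap_iInf]
    refine iInf_congr fun i => ?_
    rw [show uniformity (A i) = Filter.principal SetRel.id from rfl, Filter.comap_principal,
      Filter.comap_principal]
    rfl
  change W ∈ uniformity (compatibleFamilies m) ↔ _
  rw [h, Filter.mem_iInf_of_directed]
  · simp only [Filter.mem_principal]
  · intro i j
    obtain ⟨k, hi, hj⟩ := exists_ge_ge i j
    refine ⟨k, ?_, ?_⟩ <;> simp only [ge_iff_le, Filter.le_principal_iff, Filter.mem_principal]
    · intro p (hp : p.1.1 k = p.2.1 k)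
      change p.1.1 i = p.2.1 i
      rw [← p.1.2 _ _ hi, ← p.2.2 _ _ hi, hp]
    · intro p (hp : p.1.1 k = p.2.1 k)
      change p.1.1 j = p.2.1 j
      rw [← p.1.2 _ _ hj, ← p.2.2 _ _ hj, hp]

end InverseSystems

/-! ### Finite quotients of profinite graphs -/

theorem Setoid.finite_quotient_inf {α : Type*} {r s : Setoid α} (hr : Finite (Quotient r))
    (hs : Finite (Quotient s)) : Finite (Quotient (r ⊓ s)) := by
  refine Finite.of_injective (β := Quotient r × Quotient s)
    (fun x => (Quotient.map (sa := r ⊓ s) id (fun _ _ h => h.1) x,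
      Quotient.map (sa := r ⊓ s) id (fun _ _ h => h.2) x)) ?_
  rintro ⟨x⟩ ⟨y⟩ h
  exact Quotient.sound ⟨Quotient.exact (congrArg Prod.fst h), Quotient.exact (congrArg Prod.snd h)⟩

namespace SerreGraph

variable {G H : SerreGraph.{u}}

/-- The compatible relation "same image under `f`". -/
def Hom.ker (f : Hom G H) : G.CompatRel where
  relV := Setoid.ker f.onV
  relE := Setoid.ker f.onE
  src_rel e e' h := by
    change f.onV _ = f.onV _
    rw [← f.src_comm, ← f.src_comm, show f.onE e = f.onE e' from h]
  tgt_rel e e' h := by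
    change f.onV _ = f.onV _
    rw [← f.tgt_comm, ← f.tgt_comm, show f.onE e = f.onE e' from h]
  inv_rel e e' h := by
    change f.onE _ = f.onE _
    rw [← f.inv_comm, ← f.inv_comm, show f.onE e = f.onE e' from h]
  not_inv_rel e h := H.inv_ne (f.onE e) ((f.inv_comm e).trans h)

/-- The intersection of two compatible relations. -/
def CompatRel.inter (R S : G.CompatRel) : G.CompatRel where
  relV := R.relV ⊓ S.relV
  relE := R.relE ⊓ S.relE
  src_rel e e' h := ⟨R.src_rel e e' h.1, S.src_rel e e' h.2⟩
  tgt_rel e e' h := ⟨R.tgt_rel e e' h.1, S.tgt_rel e e' h.2⟩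
  inv_rel e e' h := ⟨R.inv_rel e e' h.1, S.inv_rel e e' h.2⟩
  not_inv_rel e h := R.not_inv_rel e h.1

theorem CompatRel.inter_finer_left (R S : G.CompatRel) : (R.inter S).Finer R :=
  ⟨inf_le_left, inf_le_left⟩

theorem CompatRel.inter_finer_right (R S : G.CompatRel) : (R.inter S).Finer S :=
  ⟨inf_le_right, inf_le_right⟩

/-- The map from the quotient graph induced by a map that is constant on the classes. -/
def quotLift {R : G.CompatRel} (f : Hom G H) (h : R.Finer f.ker) : Hom (G.quot R) H where
  onV := Quotient.lift f.onV fun _ _ hv => h.1 hv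
  onE := Quotient.lift f.onE fun _ _ he => h.2 he
  src_comm := by rintro ⟨e⟩; exact f.src_comm e
  tgt_comm := by rintro ⟨e⟩; exact f.tgt_comm e
  inv_comm := by rintro ⟨e⟩; exact f.inv_comm e

end SerreGraph

namespace ProfiniteGraph

open SerreGraph

variable {Γ Δ : ProfiniteGraph.{u}} {H K : SerreGraph.{u}}

/-- A map from a profinite graph to a discrete graph is continuous, that is, locally constant. -/
def IsLocConst (f : Hom Γ.toSerreGraph H) : Prop :=
  IsLocallyConstant f.onV ∧ IsLocallyConstant f.onE

theorem IsLocConst.comp_hom {f : Hom Γ.toSerreGraph H} (hf : IsLocConst f) (g : Hom H K) :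
    IsLocConst (g.comp f) :=
  ⟨hf.1.comp g.onV, hf.2.comp g.onE⟩

theorem IsLocConst.comp_map {f : Hom Δ.toSerreGraph H} (hf : IsLocConst f) (g : Map Γ Δ) :
    IsLocConst (f.comp g.toHom) :=
  ⟨hf.1.comp_continuous g.continuous_onV, hf.2.comp_continuous g.continuous_onE⟩

theorem IsLocConst.ker {f : Hom Γ.toSerreGraph H} (hf : IsLocConst f) :
    Γ.IsCofiniteEntourage f.ker := by
  have key : ∀ {X : Type u} [UniformSpace X] [CompactSpace X] {Y : Type u} {g : X → Y},
      IsLocallyConstant g → {x : X × X | Setoid.ker g x.1 x.2} ∈ uniformity X ∧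
        Finite (Quotient (Setoid.ker g)) := by
    intro X _ _ Y g hg
    refine ⟨?_, ?_⟩
    · rw [← nhdsSet_diagonal_eq_uniformity]
      refine hg.isOpen_setOf_eq.mem_nhdsSet.2 ?_
      rintro ⟨x, y⟩ (rfl : x = y)
      exact rfl
    · have := hg.range_finite.to_subtype
      exact Finite.of_equiv _ (Setoid.quotientKerEquivRange g).symm
  exact ⟨(key hf.1).1, (key hf.2).1, (key hf.1).2, (key hf.2).2⟩

theorem IsCofiniteEntourage.inter {R S : Γ.toSerreGraph.CompatRel} (hR : Γ.IsCofiniteEntourage R)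
    (hS : Γ.IsCofiniteEntourage S) : Γ.IsCofiniteEntourage (R.inter S) :=
  ⟨Filter.inter_mem hR.1 hS.1, Filter.inter_mem hR.2.1 hS.2.1,
    Setoid.finite_quotient_inf hR.2.2.1 hS.2.2.1, Setoid.finite_quotient_inf hR.2.2.2 hS.2.2.2⟩

theorem IsCofiniteEntourage.isLocConst_proj {R : Γ.toSerreGraph.CompatRel}
    (hR : Γ.IsCofiniteEntourage R) : IsLocConst (Γ.toSerreGraph.proj R) := by
  refine ⟨(IsLocallyConstant.iff_eventually_eq _).2 fun x => ?_,
    (IsLocallyConstant.iff_eventually_eq _).2 fun x => ?_⟩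
  · filter_upwards [mem_nhds_left x hR.1] with y hy
    exact (Quotient.sound hy).symm
  · filter_upwards [mem_nhds_left x hR.2.1] with y hy
    exact (Quotient.sound hy).symm

theorem exists_isCofiniteEntourage (Γ : ProfiniteGraph.{u}) :
    ∃ R : Γ.toSerreGraph.CompatRel, Γ.IsCofiniteEntourage R := by
  obtain ⟨R, hR, -⟩ := Γ.exists_compatRel _ Filter.univ_mem _ Filter.univ_mem
  exact ⟨R, hR⟩

theorem IsConnected.nonempty (hΓ : Γ.IsConnected) : Nonempty Γ.V := by
  obtain ⟨R, hR⟩ := Γ.exists_isCofiniteEntourage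
  obtain ⟨⟨v⟩⟩ := (hΓ R hR).1
  exact ⟨v⟩

/-- Two locally constant lifts of a map from a connected profinite graph that agree at a vertex are
equal. -/
theorem IsConnected.lift_unique (hΓ : Γ.IsConnected) {f : Hom K H} (hf : f.LocallyBijective)
    {h h' : Hom Γ.toSerreGraph K} (hh : IsLocConst h) (hh' : IsLocConst h')
    (hc : f.comp h = f.comp h') {c : Γ.V} (hv : h.onV c = h'.onV c) : h = h' := by
  have hconn := hΓ _ (hh.ker.inter hh'.ker)
  have key := hf.lift_unique hconn (h := quotLift h (h.ker.inter_finer_left h'.ker))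
    (h' := quotLift h' (h.ker.inter_finer_right h'.ker)) (v := Quotient.mk _ c)
    (Hom.ext (by funext x; obtain ⟨x⟩ := x; exact Hom.onV_congr hc x)
      (by funext x; obtain ⟨x⟩ := x; exact Hom.onE_congr hc x)) hv
  exact Hom.ext (funext fun x => Hom.onV_congr key (Quotient.mk _ x))
    (funext fun x => Hom.onE_congr key (Quotient.mk _ x))

/-! ### Inverse limits of finite graphs -/

section Limits

variable {I : Type u} [Preorder I] {A B : System I}
  {π : ∀ i, Hom Γ.toSerreGraph (A.obj i)}

theorem IsLimit.isLocConst (h : IsLimit A Γ π) (i : I) : IsLocConst (π i) :=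
  ⟨h.continuous_onV i, h.continuous_onE i⟩

theorem IsLimit.ext_V (h : IsLimit A Γ π) {x y : Γ.V} (hxy : ∀ i, (π i).onV x = (π i).onV y) :
    x = y :=
  (h.existsUnique_V (fun i => (π i).onV y) fun hij => Hom.onV_congr (h.comm hij) y).unique hxy
    fun _ => rfl

theorem IsLimit.ext_E (h : IsLimit A Γ π) {x y : Γ.E} (hxy : ∀ i, (π i).onE x = (π i).onE y) :
    x = y :=
  (h.existsUnique_E (fun i => (π i).onE y) fun hij => Hom.onE_congr (h.comm hij) y).unique hxy
    fun _ => rfl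

theorem IsLimit.hom_ext (h : IsLimit A Γ π) {f g : Hom H Γ.toSerreGraph}
    (hfg : ∀ i, (π i).comp f = (π i).comp g) : f = g :=
  Hom.ext (funext fun x => h.ext_V fun i => Hom.onV_congr (hfg i) x)
    (funext fun x => h.ext_E fun i => Hom.onE_congr (hfg i) x)

/-- The universal property of the inverse limit. -/
theorem IsLimit.exists_map (h : IsLimit A Γ π) (g : ∀ i, Hom Δ.toSerreGraph (A.obj i))
    (hg : ∀ i, IsLocConst (g i)) (hcomm : ∀ {i j : I} (hij : i ≤ j), (A.map hij).comp (g j) = g i) :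
    ∃ f : Map Δ Γ, ∀ i, (π i).comp f.toHom = g i := by
  choose fV hfV using fun v => (h.existsUnique_V (fun i => (g i).onV v)
    fun hij => Hom.onV_congr (hcomm hij) v).exists
  choose fE hfE using fun e => (h.existsUnique_E (fun i => (g i).onE e)
    fun hij => Hom.onE_congr (hcomm hij) e).exists
  refine ⟨⟨⟨fV, fE, fun e => h.ext_V fun i => ?_, fun e => h.ext_V fun i => ?_,
    fun e => h.ext_E fun i => ?_⟩, ?_, ?_⟩, fun i => Hom.ext (funext fun v => hfV v i)
      (funext fun e => hfE e i)⟩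
  · rw [← (π i).src_comm, hfE, hfV, (g i).src_comm]
  · rw [← (π i).tgt_comm, hfE, hfV, (g i).tgt_comm]
  · rw [← (π i).inv_comm, hfE, hfE, (g i).inv_comm]
  · refine continuous_of_isLocallyConstant_comp h.continuous_onV (fun _ _ => h.ext_V) fun i => ?_
    rw [show (π i).onV ∘ fV = (g i).onV from funext fun v => hfV v i]
    exact (hg i).1
  · refine continuous_of_isLocallyConstant_comp h.continuous_onE (fun _ _ => h.ext_E) fun i => ?_
    rw [show (π i).onE ∘ fE = (g i).onE from funext fun v => hfE v i]
    exact (hg i).2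

/-- A locally constant map on an inverse limit `Γ` of finite graphs `A i` factors through some
`A k`. As `Γ → A k` need not be surjective, the factorization over `A k` is obtained from a map
defined on the image of `Γ` in some `A j`, where `k ≥ j` is such that this image contains the
image of `A k`. -/
theorem IsLimit.exists_factor [Nonempty I] [IsDirectedOrder I] (h : IsLimit A Γ π)
    (hA : A.IsFinite) {q : Hom Γ.toSerreGraph H} (hq : IsLocConst q) :
    ∃ (k : I) (r : Hom (A.obj k) H), r.comp (π k) = q := by
  have hV := hq.1.exists_ker_le h.continuous_onV
    (fun {i j} hij x y hxy => by
      rw [← h.comm hij]; exact congrArg (A.map hij).onV hxy) (fun _ _ => h.ext_V)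
  have hE := hq.2.exists_ker_le h.continuous_onE
    (fun {i j} hij x y hxy => by
      rw [← h.comm hij]; exact congrArg (A.map hij).onE hxy) (fun _ _ => h.ext_E)
  obtain ⟨j₁, hj₁⟩ := hV
  obtain ⟨j₂, hj₂⟩ := hE
  obtain ⟨j, h₁, h₂⟩ := exists_ge_ge j₁ j₂
  have hjV : ∀ x y, (π j).onV x = (π j).onV y → q.onV x = q.onV y := fun x y hxy => by
    refine hj₁ x y ?_
    rw [← h.comm h₁]
    exact congrArg (A.map h₁).onV hxy
  have hjE : ∀ x y, (π j).onE x = (π j).onE y → q.onE x = q.onE y := fun x y hxy => by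
    refine hj₂ x y ?_
    rw [← h.comm h₂]
    exact congrArg (A.map h₂).onE hxy
  obtain ⟨k₁, hk₁, hV⟩ := exists_transition_mem (A := fun i => (A.obj i).V) (fun i => (hA i).1)
    (fun hij => (A.map hij).onV) (fun i x => Hom.onV_congr (A.map_refl i) x)
    (fun hij hjk x => Hom.onV_congr (A.map_trans hij hjk) x) j (Set.range (π j).onV)
    (fun x hx => by
      obtain ⟨v, hv, -⟩ := h.existsUnique_V x hx
      exact ⟨v, hv j⟩)
  obtain ⟨k₂, hk₂, hE⟩ := exists_transition_mem (A := fun i => (A.obj i).E) (fun i => (hA i).2)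
    (fun hij => (A.map hij).onE) (fun i x => Hom.onE_congr (A.map_refl i) x)
    (fun hij hjk x => Hom.onE_congr (A.map_trans hij hjk) x) j (Set.range (π j).onE)
    (fun x hx => by
      obtain ⟨v, hv, -⟩ := h.existsUnique_E x hx
      exact ⟨v, hv j⟩)
  obtain ⟨k, hkk₁, hkk₂⟩ := exists_ge_ge k₁ k₂
  have hjk : j ≤ k := hk₁.trans hkk₁
  have hV' : ∀ x, ∃ v, (π j).onV v = (A.map hjk).onV x := fun x => by
    rw [A.map_trans hk₁ hkk₁]
    exact hV _
  have hE' : ∀ x, ∃ e, (π j).onE e = (A.map hjk).onE x := fun x => by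
    rw [A.map_trans hk₂ hkk₂]
    exact hE _
  choose tV htV using hV'
  choose tE htE using hE'
  refine ⟨k, ⟨fun x => q.onV (tV x), fun x => q.onE (tE x), fun e => ?_, fun e => ?_, fun e => ?_⟩,
    Hom.ext (funext fun x => ?_) (funext fun x => ?_)⟩
  · rw [q.src_comm]
    exact hjV _ _ (by rw [← (π j).src_comm, htE, htV, (A.map hjk).src_comm])
  · rw [q.tgt_comm]
    exact hjV _ _ (by rw [← (π j).tgt_comm, htE, htV, (A.map hjk).tgt_comm])
  · rw [q.inv_comm]
    exact hjE _ _ (by rw [← (π j).inv_comm, htE, htE, (A.map hjk).inv_comm])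
  · exact hjV _ _ ((htV _).trans (Hom.onV_congr (h.comm hjk) x))
  · exact hjE _ _ ((htE _).trans (Hom.onE_congr (h.comm hjk) x))

/-- An inverse limit of finite path connected graphs is connected, even if the transition maps are
not surjective: a finite quotient of the limit is a quotient of one of the graphs. -/
theorem IsLimit.isConnected [Nonempty I] [IsDirectedOrder I] (h : IsLimit A Γ π)
    (hA : A.IsFinite) (hconn : ∀ i, (A.obj i).PathConnected) (hne : Nonempty Γ.V) :
    Γ.IsConnected := by
  intro R hR
  obtain ⟨k, r, hr⟩ := h.exists_factor hA hR.isLocConst_proj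
  obtain ⟨v₀⟩ := hne
  refine ⟨⟨Quotient.mk _ v₀⟩, ?_⟩
  rintro ⟨u⟩ ⟨v⟩
  obtain ⟨l, hl⟩ := (hconn k).2 ((π k).onV u) ((π k).onV v)
  have h1 : r.onV ((π k).onV u) = Quotient.mk _ u := Hom.onV_congr hr u
  have h2 : r.onV ((π k).onV v) = Quotient.mk _ v := Hom.onV_congr hr v
  have h3 := hl.map r
  rw [h1, h2] at h3
  exact ⟨l.map r.onE, h3⟩

/-- The graph of compatible families of an inverse system. The index set has to be nonempty, since
otherwise there would be an edge that is its own inverse. -/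
def limitGraph (A : System I) [hI : Nonempty I] : SerreGraph.{u} where
  V := compatibleFamilies (A := fun i => (A.obj i).V) fun hij => (A.map hij).onV
  E := compatibleFamilies (A := fun i => (A.obj i).E) fun hij => (A.map hij).onE
  src e := ⟨fun i => (A.obj i).src (e.1 i), fun i j hij =>
    ((A.map hij).src_comm _).symm.trans (congrArg (A.obj i).src (e.2 i j hij))⟩
  tgt e := ⟨fun i => (A.obj i).tgt (e.1 i), fun i j hij =>
    ((A.map hij).tgt_comm _).symm.trans (congrArg (A.obj i).tgt (e.2 i j hij))⟩
  inv e := ⟨fun i => (A.obj i).inv (e.1 i), fun i j hij =>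
    ((A.map hij).inv_comm _).symm.trans (congrArg (A.obj i).inv (e.2 i j hij))⟩
  inv_inv e := Subtype.ext (funext fun i => (A.obj i).inv_inv (e.1 i))
  inv_ne e h := (A.obj hI.some).inv_ne (e.1 hI.some) (congrFun (congrArg Subtype.val h) hI.some)
  src_inv e := Subtype.ext (funext fun i => (A.obj i).src_inv (e.1 i))
  tgt_inv e := Subtype.ext (funext fun i => (A.obj i).tgt_inv (e.1 i))

/-- The projections of `limitGraph A`. -/
def limitProj (A : System I) [Nonempty I] (i : I) : Hom (limitGraph A) (A.obj i) where
  onV v := v.1 i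
  onE e := e.1 i
  src_comm _ := rfl
  tgt_comm _ := rfl
  inv_comm _ := rfl

theorem exists_isLimit [Nonempty I] [IsDirectedOrder I] (hA : A.IsFinite) :
    ∃ (Γ : ProfiniteGraph.{u}) (π : ∀ i, Hom Γ.toSerreGraph (A.obj i)), IsLimit A Γ π := by
  let uV : UniformSpace (limitGraph A).V := familyUniformSpace _
  let uE : UniformSpace (limitGraph A).E := familyUniformSpace _
  have cV : CompactSpace (limitGraph A).V := compactSpace_compatibleFamilies _ fun i => (hA i).1
  have cE : CompactSpace (limitGraph A).E := compactSpace_compatibleFamilies _ fun i => (hA i).2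
  have lV : ∀ i, IsLocallyConstant (limitProj A i).onV := fun i => isLocallyConstant_family _ i
  have lE : ∀ i, IsLocallyConstant (limitProj A i).onE := fun i => isLocallyConstant_family _ i
  refine ⟨{
    toSerreGraph := limitGraph A
    uniformV := uV
    uniformE := uE
    compactV := cV
    compactE := cE
    hausdorffV := t2Space_family _
    hausdorffE := t2Space_family _
    exists_compatRel := ?_ }, limitProj A, ⟨lV, lE, ?_, ?_, ?_⟩⟩
  · intro W hW W' hW'
    obtain ⟨i, hi⟩ := (mem_uniformity_compatibleFamilies _ W).1 hW
    obtain ⟨i', hi'⟩ := (mem_uniformity_compatibleFamilies _ W').1 hW'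
    obtain ⟨k, hk, hk'⟩ := exists_ge_ge i i'
    refine ⟨(limitProj A k).ker, ⟨?_, ?_, ?_, ?_⟩, ?_, ?_⟩
    · exact (mem_uniformity_compatibleFamilies _ _).2 ⟨k, subset_rfl⟩
    · exact (mem_uniformity_compatibleFamilies _ _).2 ⟨k, subset_rfl⟩
    · have := (hA k).1
      exact Finite.of_equiv _ (Setoid.quotientKerEquivRange (limitProj A k).onV).symm
    · have := (hA k).2
      exact Finite.of_equiv _ (Setoid.quotientKerEquivRange (limitProj A k).onE).symm
    · rintro ⟨x, y⟩ (h : x.1 k = y.1 k)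
      refine hi ?_
      change x.1 i = y.1 i
      rw [← x.2 _ _ hk, ← y.2 _ _ hk, h]
    · rintro ⟨x, y⟩ (h : x.1 k = y.1 k)
      refine hi' ?_
      change x.1 i' = y.1 i'
      rw [← x.2 _ _ hk', ← y.2 _ _ hk', h]
  · intro i j hij
    exact Hom.ext (funext fun v => v.2 i j hij) (funext fun e => e.2 i j hij)
  · intro x hx
    exact ⟨⟨x, fun i j h => hx h⟩, fun i => rfl, fun y hy => Subtype.ext (funext hy)⟩
  · intro x hx
    exact ⟨⟨x, fun i j h => hx h⟩, fun i => rfl, fun y hy => Subtype.ext (funext hy)⟩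

end Limits

end ProfiniteGraph

/-! ### Fiber products of graphs -/

namespace SerreGraph

variable {A G H K : SerreGraph.{u}}

theorem Hom.locallyBijective_id : (Hom.id G).LocallyBijective :=
  fun _ e' he' => ⟨e', ⟨he', rfl⟩, fun _ he => he.2⟩

/-- The fiber product of two maps of graphs. -/
def pullback (f : Hom K H) (r : Hom A H) : SerreGraph.{u} where
  V := {x : K.V × A.V // f.onV x.1 = r.onV x.2}
  E := {x : K.E × A.E // f.onE x.1 = r.onE x.2}
  src x := ⟨(K.src x.1.1, A.src x.1.2), by rw [← f.src_comm, ← r.src_comm, x.2]⟩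
  tgt x := ⟨(K.tgt x.1.1, A.tgt x.1.2), by rw [← f.tgt_comm, ← r.tgt_comm, x.2]⟩
  inv x := ⟨(K.inv x.1.1, A.inv x.1.2), by rw [← f.inv_comm, ← r.inv_comm, x.2]⟩
  inv_inv x := Subtype.ext (Prod.ext (K.inv_inv _) (A.inv_inv _))
  inv_ne x h := K.inv_ne x.1.1 (congrArg (fun y => y.1.1) h)
  src_inv x := Subtype.ext (Prod.ext (K.src_inv _) (A.src_inv _))
  tgt_inv x := Subtype.ext (Prod.ext (K.tgt_inv _) (A.tgt_inv _))

/-- The first projection of the fiber product. -/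
def pullbackFst (f : Hom K H) (r : Hom A H) : Hom (pullback f r) K where
  onV x := x.1.1
  onE x := x.1.1
  src_comm _ := rfl
  tgt_comm _ := rfl
  inv_comm _ := rfl

/-- The second projection of the fiber product. -/
def pullbackSnd (f : Hom K H) (r : Hom A H) : Hom (pullback f r) A where
  onV x := x.1.2
  onE x := x.1.2
  src_comm _ := rfl
  tgt_comm _ := rfl
  inv_comm _ := rfl

theorem pullback_comm (f : Hom K H) (r : Hom A H) :
    f.comp (pullbackFst f r) = r.comp (pullbackSnd f r) :=
  Hom.ext (funext fun x => x.2) (funext fun x => x.2)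

theorem pullbackSnd_locallyBijective {f : Hom K H} (hf : f.LocallyBijective) (r : Hom A H) :
    (pullbackSnd f r).LocallyBijective := by
  rintro ⟨⟨w, v⟩, hwv⟩ e (rfl : A.src e = v)
  obtain ⟨e₁, ⟨rfl, he₁⟩, hu⟩ := hf w (r.onE e) ((r.src_comm e).trans hwv.symm)
  refine ⟨⟨(e₁, e), he₁⟩, ⟨rfl, rfl⟩, ?_⟩
  rintro ⟨⟨e₂, e'⟩, he₂⟩ ⟨h1, rfl : e' = e⟩
  exact Subtype.ext (Prod.ext (hu e₂ ⟨congrArg (fun x => x.1.1) h1, he₂⟩) rfl)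

end SerreGraph

theorem Subgroup.finiteIndex_comap_of_normal {G H : Type*} [Group G] [Group H] (f : G →* H)
    (N : Subgroup H) [N.Normal] [N.FiniteIndex] : (N.comap f).FiniteIndex := by
  have h : N.comap f = ((QuotientGroup.mk' N).comp f).ker := by
    rw [← MonoidHom.comap_ker, QuotientGroup.ker_mk']
  rw [h]
  infer_instance

namespace ProfiniteGraph

open SerreGraph

variable {D T Γ Δ : ProfiniteGraph.{u}}

/-- The identity of a profinite graph. -/
def Map.id (Γ : ProfiniteGraph.{u}) : Map Γ Γ :=
  ⟨Hom.id Γ.toSerreGraph, continuous_id, continuous_id⟩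

/-- Composition `g ∘ f` of continuous maps of profinite graphs. -/
def Map.comp (g : Map T Δ) (f : Map D T) : Map D Δ :=
  ⟨g.toHom.comp f.toHom, g.continuous_onV.comp f.continuous_onV,
    g.continuous_onE.comp f.continuous_onE⟩

theorem Map.ext_toHom {f g : Map D T} (h : f.toHom = g.toHom) : f = g := by
  cases f; cases g; cases h; rfl

/-! ### Lifting to finite and to profinite coverings -/

/-- Every composition of `p : D → T` with a continuous map to a discrete graph lifts through every
locally bijective map with finite source, with arbitrary prescribed value at a vertex. -/
def HasFiniteLifting (p : Map D T) : Prop :=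
  ∀ (K H : SerreGraph.{u}) (f : Hom K H), Finite K.V → Finite K.E → f.LocallyBijective →
    ∀ q : Hom T.toSerreGraph H, IsLocConst q → ∀ (c : D.V) (w : K.V),
      q.onV (p.onV c) = f.onV w →
        ∃ h : Hom D.toSerreGraph K, IsLocConst h ∧ f.comp h = q.comp p.toHom ∧ h.onV c = w

/-- Two lifts of a map to a profinite covering that agree at a vertex are equal. -/
theorem Map.IsCovering.lift_unique {f : Map Γ Δ} (hf : f.IsCovering) (hD : D.IsConnected)
    {h h' : Map D Γ} (hc : f.comp h = f.comp h') {c : D.V} (hv : h.onV c = h'.onV c) : h = h' := by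
  obtain ⟨I, _, _, _, A, B, F, φ, ψ, hA, hB, hF, hlim⟩ := hf
  refine Map.ext_toHom (hlim.isLimit_source.hom_ext fun i => ?_)
  have hloc := hlim.isLimit_source.isLocConst i
  refine hD.lift_unique (hF i) (hloc.comp_map h) (hloc.comp_map h') ?_
    (congrArg (φ i).onV hv)
  change ((F.app i).comp (φ i)).comp h.toHom = ((F.app i).comp (φ i)).comp h'.toHom
  rw [hlim.comm i]
  exact congrArg (fun k : Map D Δ => (ψ i).comp k.toHom) hc

/-- The finite lifts over the approximations of a covering fit together, by uniqueness of lifts, and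
so give a lift to the covering itself. -/
theorem HasFiniteLifting.exists_map {p : Map D T} (hp : HasFiniteLifting p) (hD : D.IsConnected)
    (g : Map T Δ) {f : Map Γ Δ} (hf : f.IsCovering) {c : D.V} {a : Γ.V}
    (hca : g.onV (p.onV c) = f.onV a) :
    ∃ h : Map D Γ, f.comp h = g.comp p ∧ h.onV c = a := by
  obtain ⟨I, _, _, _, A, B, F, φ, ψ, hA, hB, hF, hlim⟩ := hf
  have hex : ∀ i, ∃ h : Hom D.toSerreGraph (A.obj i), IsLocConst h ∧
      (F.app i).comp h = ((ψ i).comp g.toHom).comp p.toHom ∧ h.onV c = (φ i).onV a := by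
    intro i
    refine hp _ _ (F.app i) (hA i).1 (hA i).2 (hF i) ((ψ i).comp g.toHom)
      ((hlim.isLimit_target.isLocConst i).comp_map g) c _ ?_
    exact (congrArg (ψ i).onV hca).trans (Hom.onV_congr (hlim.comm i) a).symm
  choose k hk hkF hkc using hex
  obtain ⟨h, hh⟩ := hlim.isLimit_source.exists_map k hk (by
    intro i j hij
    refine hD.lift_unique (hF i) ((hk j).comp_hom _) (hk i) ?_ (c := c) ?_
    · calc (F.app i).comp ((A.map hij).comp (k j))
          = ((F.app i).comp (A.map hij)).comp (k j) := rfl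
        _ = (B.map hij).comp ((F.app j).comp (k j)) := by rw [F.comm hij]; rfl
        _ = ((B.map hij).comp (ψ j)).comp (g.toHom.comp p.toHom) := by rw [hkF j]; rfl
        _ = (F.app i).comp (k i) := by rw [hlim.isLimit_target.comm hij, hkF i]; rfl
    · change (A.map hij).onV ((k j).onV c) = _
      rw [hkc, hkc]
      exact Hom.onV_congr (hlim.isLimit_source.comm hij) a)
  refine ⟨h, Map.ext_toHom (hlim.isLimit_target.hom_ext fun i => ?_),
    hlim.isLimit_source.ext_V fun i => (Hom.onV_congr (hh i) c).trans (hkc i)⟩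
  calc (ψ i).comp (f.toHom.comp h.toHom)
      = ((ψ i).comp f.toHom).comp h.toHom := rfl
    _ = (F.app i).comp ((φ i).comp h.toHom) := by rw [← hlim.comm i]; rfl
    _ = (ψ i).comp (g.toHom.comp p.toHom) := by rw [hh i, hkF i]; rfl

/-- The lifting property passes from `p = g ∘ h` to `h` if `g` is a covering. A map from `T` to a
discrete graph factors through a finite covering graph approximating `g`, and the fiber product
with the given finite covering graph is again a finite covering graph of an approximation
of `Δ`. -/
theorem HasFiniteLifting.of_comp {g : Map T Δ} {h : Map D T} (hp : HasFiniteLifting (g.comp h))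
    (hD : D.IsConnected) (hg : g.IsCovering) : HasFiniteLifting h := by
  obtain ⟨I, _, _, _, A, B, F, φ, ψ, hA, hB, hF, hlim⟩ := hg
  intro K H f hKV hKE hf q hq c w hw
  obtain ⟨k, r, rfl⟩ := hlim.isLimit_source.exists_factor hA hq
  have := (hA k).1
  have := (hA k).2
  have hcomm : ((F.app k).comp (φ k)).comp h.toHom = ((ψ k).comp g.toHom).comp h.toHom := by
    rw [hlim.comm k]
  obtain ⟨l, hl, hlF, hlc⟩ := hp (pullback f r) _ ((F.app k).comp (pullbackSnd f r))
    (inferInstanceAs (Finite (Subtype _))) (inferInstanceAs (Finite (Subtype _)))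
    ((hF k).comp (pullbackSnd_locallyBijective hf r)) (ψ k) (hlim.isLimit_target.isLocConst k) c
    ⟨(w, (φ k).onV (h.onV c)), hw.symm⟩ (Hom.onV_congr hcomm c).symm
  have hs : (pullbackSnd f r).comp l = (φ k).comp h.toHom :=
    hD.lift_unique (hF k) (hl.comp_hom _) ((hlim.isLimit_source.isLocConst k).comp_map h)
      (hlF.trans hcomm.symm) (congrArg (fun x => x.1.2) hlc)
  refine ⟨(pullbackFst f r).comp l, hl.comp_hom _, ?_, congrArg (fun x => x.1.1) hlc⟩
  calc f.comp ((pullbackFst f r).comp l)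
      = (f.comp (pullbackFst f r)).comp l := rfl
    _ = r.comp ((pullbackSnd f r).comp l) := by rw [pullback_comm]; rfl
    _ = _ := by rw [hs]; rfl

/-! ### The system of finite quotients -/

instance (Δ : ProfiniteGraph.{u}) (b : Δ.V) : Nonempty (CoverIndex Δ b) := by
  obtain ⟨R, hR⟩ := Δ.exists_isCofiniteEntourage
  exact ⟨⟨R, hR, ⊤, inferInstance, inferInstance⟩⟩

instance (Δ : ProfiniteGraph.{u}) (b : Δ.V) : IsDirectedOrder (CoverIndex Δ b) := by
  refine ⟨fun i j => ?_⟩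
  have := i.normal
  have := j.normal
  have := i.finiteIndex
  have := j.finiteIndex
  let hi := i.rel.inter_finer_left j.rel
  let hj := i.rel.inter_finer_right j.rel
  let b' := (Δ.toSerreGraph.proj (i.rel.inter j.rel)).onV b
  let fi := pi1Map (quotMap hi) (a := b') (b := (Δ.toSerreGraph.proj i.rel).onV b) rfl
  let fj := pi1Map (quotMap hj) (a := b') (b := (Δ.toSerreGraph.proj j.rel).onV b) rfl
  have := Subgroup.finiteIndex_comap_of_normal fi i.N
  have := Subgroup.finiteIndex_comap_of_normal fj j.N
  exact ⟨⟨i.rel.inter j.rel, i.isCofiniteEntourage.inter j.isCofiniteEntourage,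
    i.N.comap fi ⊓ j.N.comap fj, inferInstance, inferInstance⟩,
    ⟨hi, fun x hx => hx.1⟩, ⟨hj, fun x hx => hx.2⟩⟩

theorem quotSystem_isFinite (b : Δ.V) : (quotSystem Δ b).IsFinite :=
  fun j => ⟨j.isCofiniteEntourage.2.2.1, j.isCofiniteEntourage.2.2.2⟩

theorem isLimit_quotSystem (b : Δ.V) :
    IsLimit (quotSystem Δ b) Δ fun j => Δ.toSerreGraph.proj j.rel := by
  have hloc := fun j : CoverIndex Δ b => j.isCofiniteEntourage.isLocConst_proj
  refine ⟨fun j => (hloc j).1, fun j => (hloc j).2, fun _ => rfl, fun x hx => ?_, fun x hx => ?_⟩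
  · refine existsUnique_of_surjective_of_compact (fun h => ((quotSystem Δ b).map h).onV)
      (fun j => (hloc j).1) (fun _ _ => rfl) (fun _ => Quotient.mk_surjective) ?_ x hx
    intro v w hvw
    -- The pairs `(R, ⊤)` already separate the points.
    refine eq_of_uniformity fun {W} hW => ?_
    obtain ⟨R, hR, hRW, -⟩ := Δ.exists_compatRel W hW _ Filter.univ_mem
    exact hRW (Quotient.exact (hvw ⟨R, hR, ⊤, inferInstance, inferInstance⟩))
  · refine existsUnique_of_surjective_of_compact (fun h => ((quotSystem Δ b).map h).onE)
      (fun j => (hloc j).2) (fun _ _ => rfl) (fun _ => Quotient.mk_surjective) ?_ x hx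
    intro v w hvw
    refine eq_of_uniformity fun {W} hW => ?_
    obtain ⟨R, hR, -, hRW⟩ := Δ.exists_compatRel _ Filter.univ_mem W hW
    exact hRW (Quotient.exact (hvw ⟨R, hR, ⊤, inferInstance, inferInstance⟩))

/-- The vertex `b` only serves to index the finite quotients by `CoverIndex Δ b`. -/
theorem Map.isCovering_id (b : Δ.V) : (Map.id Δ).IsCovering :=
  ⟨CoverIndex Δ b, inferInstance, inferInstance, inferInstance, quotSystem Δ b, quotSystem Δ b,
    ⟨fun _ => Hom.id _, fun _ => rfl⟩, _, _, quotSystem_isFinite b, quotSystem_isFinite b,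
    fun _ => Hom.locallyBijective_id, isLimit_quotSystem b, isLimit_quotSystem b, fun _ => rfl⟩

/-! ### The limit of the finite normal coverings -/

/-- For each base point of a connected profinite graph, the finite coverings belonging to the pairs
`(S, N)` form an inverse system, the transition maps being the unique lifts that preserve the base
points; its limit exists. -/
theorem IsConnected.exists_isLimitOfNormalCovers (hΔ : Δ.IsConnected) (b : Δ.V) :
    ∃ (D : ProfiniteGraph.{u}) (p : Map D Δ) (c : D.V), p.onV c = b ∧
      IsLimitOfNormalCovers p c := by
  have hB := quotSystem_isFinite b
  choose A F a ha hAV hAE hreg hrange using fun j : CoverIndex Δ b =>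
    exists_normalCover (hΔ j.rel j.isCofiniteEntourage) (hB j).1 (hB j).2
      ((Δ.toSerreGraph.proj j.rel).onV b) j.N j.normal j.finiteIndex
  have htrans : ∀ (i j : CoverIndex Δ b) (h : i ≤ j), ∃ m : Hom (A j) (A i),
      (F i).comp m = ((quotSystem Δ b).map h).comp (F j) ∧ m.onV (a j) = a i := by
    intro i j h
    refine (hreg i).2.2.1.exists_lift (hreg j).1
      ((congrArg ((quotSystem Δ b).map h).onV (ha j)).trans (ha i).symm) ?_
    intro l l' w' hl hl' hm
    have h1 : pi1Map (F j) (ha j) (Quot.mk _ ⟨l, hl⟩) ∈ j.N := by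
      rw [← hrange j]
      exact ⟨_, rfl⟩
    have h2 := h.2 _ h1
    rw [← hrange i] at h2
    refine (hreg i).2.2.1.closed_of_mem_range (ha i) _ h2 hl' ?_
    rw [hm, List.map_map]
    rfl
  choose m hmF hma using htrans
  let 𝓐 : System (CoverIndex Δ b) :=
    { obj := A
      map := fun {i j} h => m i j h
      map_refl := fun i => (hreg i).2.2.1.lift_unique (hreg i).1
        (by rw [hmF, (quotSystem Δ b).map_refl]; rfl) (hma i i _)
      map_trans := fun {i j k} hij hjk => (hreg i).2.2.1.lift_unique (hreg k).1
        (by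
          refine (hmF i k (hij.trans hjk)).trans ?_
          rw [(quotSystem Δ b).map_trans hij hjk]
          refine (congrArg ((quotSystem Δ b).map hij).comp (hmF j k hjk).symm).trans ?_
          exact congrArg (fun f => Hom.comp f (m j k hjk)) (hmF i j hij).symm)
        ((hma i k _).trans (by
          change _ = (m i j hij).onV ((m j k hjk).onV (a k))
          rw [hma, hma])) }
  let 𝓕 : SystemMap 𝓐 (quotSystem Δ b) := ⟨F, fun {i j} h => hmF i j h⟩
  have h𝓐 : 𝓐.IsFinite := fun j => ⟨hAV j, hAE j⟩
  obtain ⟨D, φ, hφ⟩ := exists_isLimit h𝓐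
  have hΔlim := isLimit_quotSystem b
  obtain ⟨p, hp⟩ := hΔlim.exists_map (fun j => (F j).comp (φ j))
    (fun j => (hφ.isLocConst j).comp_hom _) (by
      intro i j hij
      change (((quotSystem Δ b).map hij).comp (F j)).comp (φ j) = _
      rw [← hmF i j hij, ← hφ.comm hij]
      rfl)
  obtain ⟨c, hc, -⟩ := hφ.existsUnique_V a fun {i j} h => hma i j h
  have hpc : p.onV c = b := hΔlim.ext_V fun j => by
    rw [← ha j, ← hc j]
    exact Hom.onV_congr (hp j) c
  refine ⟨D, p, c, hpc, ?_⟩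
  subst hpc
  exact ⟨inferInstance, inferInstance, 𝓐, 𝓕, φ, a, ha, h𝓐, hreg, hrange,
    fun {i j} h => hma i j h, hc, hφ, hΔlim, fun j => (hp j).symm⟩

section NormalCovers

variable {p : Map D Δ} {c : D.V}

theorem IsLimitOfNormalCovers.isRegularCovering (h : IsLimitOfNormalCovers p c) :
    p.IsRegularCovering := by
  obtain ⟨_, _, A, F, φ, a, ha, hA, hreg, hrange, hbase, hc, hlim⟩ := h
  exact ⟨_, inferInstance, inferInstance, inferInstance, A, _, F, φ, _, hA,
    quotSystem_isFinite _, hreg, hlim⟩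

theorem Map.IsRegularCovering.isCovering (h : p.IsRegularCovering) : p.IsCovering := by
  obtain ⟨I, h₁, h₂, h₃, A, B, F, φ, ψ, hA, hB, hF, hlim⟩ := h
  exact ⟨I, h₁, h₂, h₃, A, B, F, φ, ψ, hA, hB, fun i => (hF i).2.2.1, hlim⟩

theorem IsLimitOfNormalCovers.isConnected (h : IsLimitOfNormalCovers p c) : D.IsConnected := by
  obtain ⟨_, _, A, F, φ, a, ha, hA, hreg, hrange, hbase, hc, hlim⟩ := h
  exact hlim.isLimit_source.isConnected hA (fun i => (hreg i).1) ⟨c⟩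

/-- The limit of the finite normal coverings has the lifting property: for a map `q` from `Δ` to a
discrete graph, the monodromy over `Δ / ker q` of a finite covering graph is trivial on a normal
subgroup `M` of finite index, so a lift exists on the covering graph belonging to
`(ker q, M)`. -/
theorem IsLimitOfNormalCovers.hasFiniteLifting (h : IsLimitOfNormalCovers p c) :
    HasFiniteLifting p := by
  obtain ⟨_, _, A, F, φ, a, ha, hA, hreg, hrange, hbase, hc, hlim⟩ := h
  intro K H f hKV hKE hf q hq d w hw
  let r : Hom (Δ.toSerreGraph.quot q.ker) H := quotLift q ⟨le_rfl, le_rfl⟩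
  obtain ⟨σ, M, hσ, hσe, hM, hMfin, hMσ⟩ := hf.exists_normal_subgroup hKV r
    ((Δ.toSerreGraph.proj q.ker).onV (p.onV c))
  let j : CoverIndex Δ (p.onV c) := ⟨q.ker, hq.ker, M, hM, hMfin⟩
  have hqj : (r.comp (F.app j)).comp (φ j) = q.comp p.toHom := by
    change r.comp ((F.app j).comp (φ j)) = _
    rw [hlim.comm j]
    rfl
  obtain ⟨k, hkf, hkw⟩ := hf.exists_lift (q := r.comp (F.app j)) (hreg j).1
    (v₀ := (φ j).onV d) (w₀ := w) ((Hom.onV_congr hqj d).trans hw) (by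
      intro l l' w' hl hl' hm
      obtain ⟨n, hn⟩ := (hreg j).1.2 (a j) ((φ j).onV d)
      -- The walk `l` is closed at `φ j d`; its conjugate by `n` is closed at the base point.
      have hcl := (hn.append hl).append hn.rev
      have h1 : pi1Map (F.app j) (ha j) (Quot.mk _ ⟨_, hcl⟩) ∈ M := by
        change _ ∈ j.N
        rw [← hrange j]
        exact ⟨_, rfl⟩
      have h2 : (((n ++ l ++ (A.obj j).rev n).map (r.comp (F.app j)).onE).map σ).prod = 1 :=
        (congrArg (fun m => (m.map σ).prod) List.map_map.symm).trans (hMσ _ _ h1)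
      have h3 : ((((A.obj j).rev n).map (r.comp (F.app j)).onE).map σ).prod =
          (((n.map (r.comp (F.app j)).onE).map σ).prod)⁻¹ := by
        rw [Hom.map_rev, prod_voltage_rev hσ]
      have h4 : ((l.map (r.comp (F.app j)).onE).map σ).prod = 1 := by
        simp only [List.map_append, List.prod_append] at h2
        rw [h3] at h2
        simpa using h2
      have h5 := hl'.monodromy hσe
      rw [hm, h4] at h5
      exact h5)
  refine ⟨k.comp (φ j), (hlim.isLimit_source.isLocConst j).comp_hom k, ?_, hkw⟩
  rw [← hqj, ← hkf]
  rfl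

/-- Being the limit of the finite normal coverings is invariant under isomorphisms. -/
theorem IsLimitOfNormalCovers.comp_equiv (k : Map T D) (k' : Map D T) (hk : k.comp k' = Map.id D)
    (hk' : k'.comp k = Map.id T) {d : T.V} (h : IsLimitOfNormalCovers p (k.onV d)) :
    IsLimitOfNormalCovers (p.comp k) d := by
  obtain ⟨h₁, h₂, A, F, φ, a, ha, hA, hreg, hrange, hbase, hc, hlim⟩ := h
  have hV : ∀ v, k.onV (k'.onV v) = v := fun v => congrArg (fun g : Map D D => g.onV v) hk
  have hE : ∀ v, k.onE (k'.onE v) = v := fun v => congrArg (fun g : Map D D => g.onE v) hk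
  have hV' : ∀ v, k'.onV (k.onV v) = v := fun v => congrArg (fun g : Map T T => g.onV v) hk'
  have hE' : ∀ v, k'.onE (k.onE v) = v := fun v => congrArg (fun g : Map T T => g.onE v) hk'
  have hs := hlim.isLimit_source
  refine ⟨h₁, h₂, A, F, fun j => (φ j).comp k.toHom, a, ha, hA, hreg, hrange, hbase, hc,
    ⟨fun j => ((hs.isLocConst j).comp_map k).1, fun j => ((hs.isLocConst j).comp_map k).2,
      fun hij => ?_, fun x hx => ?_, fun x hx => ?_⟩, hlim.isLimit_target, fun j => ?_⟩
  · rw [← hs.comm hij]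
    rfl
  · obtain ⟨v, hv, hu⟩ := hs.existsUnique_V x hx
    refine ⟨k'.onV v, fun i => ?_, fun w hw => ?_⟩
    · exact (congrArg (φ i).onV (hV v)).trans (hv i)
    · rw [← hu _ hw, hV']
  · obtain ⟨v, hv, hu⟩ := hs.existsUnique_E x hx
    refine ⟨k'.onE v, fun i => ?_, fun w hw => ?_⟩
    · exact (congrArg (φ i).onE (hE v)).trans (hv i)
    · rw [← hu _ hw, hE']
  · exact congrArg (fun g => Hom.comp g k.toHom) (hlim.comm j)

end NormalCovers

/-! ### Universal coverings -/

theorem IsLimitOfNormalCovers.isUniversalCovering {p : Map D Δ} {c : D.V}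
    (h : IsLimitOfNormalCovers p c) : IsUniversalCovering p := by
  refine ⟨h.isConnected, h.isRegularCovering.isCovering, fun Γ f _ hf d a hda => ?_⟩
  obtain ⟨k, hk, hkd⟩ := h.hasFiniteLifting.exists_map h.isConnected (Map.id Δ) hf hda
  exact ⟨k, congrArg Map.toHom hk, hkd⟩

/-- By universality `D` maps to the limit of the finite normal coverings, whose lifting property it
inherits. -/
theorem IsUniversalCovering.hasFiniteLifting (hΔ : Δ.IsConnected) {p : Map D Δ}
    (hp : IsUniversalCovering p) : HasFiniteLifting p := by
  intro K H f hKV hKE hf q hq c w hw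
  obtain ⟨D', p', c', hpc, hlim⟩ := hΔ.exists_isLimitOfNormalCovers (p.onV c)
  obtain ⟨k, hk, hkc⟩ := hp.2.2 D' p' hlim.isConnected hlim.isRegularCovering.isCovering c c'
    hpc.symm
  obtain ⟨h, hh, hhf, hhc⟩ := hlim.hasFiniteLifting K H f hKV hKE hf q hq c' w (by rw [hpc, hw])
  refine ⟨h.comp k.toHom, hh.comp_map k, ?_, (congrArg h.onV hkc).trans hhc⟩
  calc f.comp (h.comp k.toHom)
      = (f.comp h).comp k.toHom := rfl
    _ = q.comp (p'.toHom.comp k.toHom) := by rw [hhf]; rfl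
    _ = q.comp p.toHom := by rw [show p'.toHom.comp k.toHom = p.toHom from hk]

/-- If `g ∘ h` is a universal covering of `Δ` and `g : T → Δ` a covering, then `h` is the limit of
the finite normal coverings of the finite quotients of `T`: that limit `D'` has the lifting property
over `T`, and so has `h`, whence maps between `D` and `D'` in both directions, which are inverse to
each other by the uniqueness of lifts. -/
theorem IsUniversalCovering.isLimitOfNormalCovers (hΔ : Δ.IsConnected) (hT : T.IsConnected)
    {g : Map T Δ} (hg : g.IsCovering) {h : Map D T} (hp : IsUniversalCovering (g.comp h))
    (c : D.V) : IsLimitOfNormalCovers h c := by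
  have hD := hp.1
  obtain ⟨D', p', c', hpc, hlim⟩ := hT.exists_isLimitOfNormalCovers (h.onV c)
  have hD' := hlim.isConnected
  have hp' := hlim.isRegularCovering.isCovering
  obtain ⟨k, hk, rfl⟩ := ((hp.hasFiniteLifting hΔ).of_comp hD hg).exists_map hD (Map.id T) hp'
    (c := c) (a := c') hpc.symm
  replace hk : p'.comp k = h := hk
  obtain ⟨k', hk', hkc'⟩ := hlim.hasFiniteLifting.exists_map hD' g hp.2.1 (c := k.onV c) (a := c)
    (congrArg g.onV hpc)
  have hkk : k'.comp k = Map.id D := by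
    refine hp.2.1.lift_unique hD (c := c) ?_ hkc'
    calc (g.comp h).comp (k'.comp k) = ((g.comp h).comp k').comp k := rfl
      _ = g.comp (p'.comp k) := by rw [hk']; rfl
      _ = (g.comp h).comp (Map.id D) := by rw [hk]; rfl
  have hhk : h.comp k' = p' :=
    hg.lift_unique hD' (c := k.onV c) hk' ((congrArg h.onV hkc').trans hpc.symm)
  have hkk' : k.comp k' = Map.id D' := by
    refine hp'.lift_unique hD' (c := k.onV c) ?_ (congrArg k.onV hkc')
    calc p'.comp (k.comp k') = (p'.comp k).comp k' := rfl
      _ = p'.comp (Map.id D') := by rw [hk, hhk]; rfl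
  rw [← hk]
  exact hlim.comp_equiv k k' hkk' hkk

end ProfiniteGraph

theorem mainTheorem1 (Δ : ProfiniteGraph.{u}) (hΔ : Δ.IsConnected) :
    (∃ (D : ProfiniteGraph.{u}) (p : ProfiniteGraph.Map D Δ),
      ProfiniteGraph.IsUniversalCovering p) ∧
    ∀ (D : ProfiniteGraph.{u}) (p : ProfiniteGraph.Map D Δ),
      ProfiniteGraph.IsUniversalCovering p →
        p.IsRegularCovering ∧
        (∀ c : D.V, ProfiniteGraph.IsLimitOfNormalCovers p c) ∧
        ∀ (T : ProfiniteGraph.{u}) (g : ProfiniteGraph.Map T Δ), T.IsConnected → g.IsCovering →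
          ∀ h : ProfiniteGraph.Map D T, ProfiniteGraph.IsCoveringHom p g h →
            h.IsRegularCovering := by
  obtain ⟨b⟩ := hΔ.nonempty
  refine ⟨?_, fun D p hp => ?_⟩
  · obtain ⟨D, p, c, -, h⟩ := hΔ.exists_isLimitOfNormalCovers b
    exact ⟨D, p, h.isUniversalCovering⟩
  obtain ⟨c⟩ := hp.1.nonempty
  have hlim : ∀ c, ProfiniteGraph.IsLimitOfNormalCovers p c := fun c =>
    ProfiniteGraph.IsUniversalCovering.isLimitOfNormalCovers hΔ hΔ
      (ProfiniteGraph.Map.isCovering_id b) hp c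
  refine ⟨(hlim c).isRegularCovering, hlim, fun T g hT hg h hh => ?_⟩
  obtain rfl : g.comp h = p := ProfiniteGraph.Map.ext_toHom hh
  exact (hp.isLimitOfNormalCovers hΔ hT hg c).isRegularCovering
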